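/- Let $0.5\le d<1.5$ and $0<\beta\le 2$. Let $X=(X_t)_{t\in\mathbb Z}$ be a Gaussian process satisfying Assumption $IG(d,\beta)$: its increments $U_t=X_t-X_{t-1}$ form a centered stationary process with a spectral density $f$ on $[-\pi,\pi]$ such that, for some $c_0>0$, $c_1\in\mathbb R$, $\epsilon>0$, $c_0'>0$ and all $\lambda\in(-\pi,0)\cup(0,\pi)$, $$f(\lambda)=c_0|\lambda|^{2-2d}+c_1|\lambda|^{2-2d+\beta}+O\big(|\lambda|^{2-2d+\beta+\epsilon}\big),\qquad |f'(\lambda)|\le c_0'|\lambda|^{1-2d}.$$ For $N>3m$, let $$IR_N(m)=\frac1{N-3m}\sum_{k=0}^{N-3m-1}\frac{|D_k+D_{k+m}|}{|D_k|+|D_{k+m}|},\qquad D_k=\sum_{t=k+1}^{k+m}X_{t+m}-\sum_{t=k+1}^{k+m}X_t .$$ Define $\Lambda_0(d)=\Lambda(\rho(d))$, where $$\Lambda(r)=\frac2\pi\arctan\sqrt{\frac{1+r}{1-r}}+\frac1\pi\sqrt{\frac{1+r}{1-r}}\,\log\Big(\frac2{1+r}\Big),$$ $$\rho(d)=\frac{4^{d+1.5}-9^{d+0.5}-7}{2(4-4^{d+0.5})}\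 \ (0.5<d<1.5),\qquad \rho(0.5)=\frac{9\log 3}{8\log 2}-2 .$$ Put $\theta=c_1/c_0$ if $\beta<2$ and $\theta=c_1/c_0+\tfrac16$ if $\beta=2$. Then there is a constant $K(d,\beta)\neq0$, depending only on $d$ and $\beta$, such that for every such $X$, as $m\to\infty$ and uniformly in $N>3m$, $$\mathbb E[IR_N(m)]=\begin{cases}\Lambda_0(d)+K(d,\beta)\,m^{-\beta}\,\big(\theta+o(1)\big) & \text{if }\beta<1+2d,\\[2pt] \Lambda_0(d)+K(0.5,2)\,m^{-2}\log m\,\big(\theta+o(1)\big) & \text{if }\beta=2\text{ and }d=0.5.\end{cases}$$ In particular, whenever $\theta\ne0$, the bias $\mathbb E[IR_N(m)]-\Lambda_0(d)$ equals $\theta K(d,\beta)m^{-\beta}(1+o(1))$, respectively $\theta K(0.5,2)m^{-2}\log m\,(1+o(1))$. -/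

import Mathlib

open MeasureTheory ProbabilityTheory Filter Topology

noncomputable section

/-- `U` is a (second order) stationary process indexed by `ℤ` with spectral density `f` on
`[-π, π]`: constant mean, and `Cov(U_{t+h}, U_t) = ∫_{-π}^{π} e^{i h x} f(x) dx`.
For Gaussian processes this is the same as strict stationarity. -/
structure HasSpectralDensity {Ω : Type*} [MeasurableSpace Ω] (P : Measure Ω)
    (U : ℤ → Ω → ℝ) (f : ℝ → ℝ) : Prop where
  memLp : ∀ t, MemLp (U t) 2 P
  mean_const : ∀ s t, ∫ ω, U s ω ∂P = ∫ ω, U t ω ∂P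
  nonneg : ∀ x ∈ Set.Icc (-Real.pi) Real.pi, 0 ≤ f x
  integrableOn : IntegrableOn f (Set.Icc (-Real.pi) Real.pi) volume
  covariance_eq : ∀ t h : ℤ, ((covariance (U (t + h)) (U t) P : ℝ) : ℂ) =
    ∫ x in (-Real.pi)..Real.pi, Complex.exp (Complex.I * (h : ℂ) * (x : ℂ)) * (f x : ℂ)

/-- For some `ε > 0`, on `(-π, 0) ∪ (0, π)`:
`f(x) = c₀ |x|^a + c₁ |x|^(a+β) + O(|x|^(a+β+ε))`, and `f` is differentiable with
`|f'(x)| ≤ c₀' |x|^(a-1)`. -/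
def SpectralExpansion (f : ℝ → ℝ) (a β c₀ c₁ : ℝ) : Prop :=
  ∃ ε > 0, ∃ c₀' > 0, ∃ C : ℝ, ∀ x ∈ Set.Ioo (-Real.pi) 0 ∪ Set.Ioo 0 Real.pi,
    |f x - (c₀ * |x| ^ a + c₁ * |x| ^ (a + β))| ≤ C * |x| ^ (a + β + ε) ∧
    DifferentiableAt ℝ f x ∧ |deriv f x| ≤ c₀' * |x| ^ (a - 1)

/-- The Gaussian semiparametric class `IG(d, β)`, with the two leading coefficients `c₀ > 0` and
`c₁ ∈ ℝ` of the spectral density displayed. -/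
def IsIG {Ω : Type*} [MeasurableSpace Ω] (P : Measure Ω) (X : ℤ → Ω → ℝ)
    (d β c₀ c₁ : ℝ) : Prop :=
  IsGaussianProcess X P ∧ 0 < c₀ ∧
  (d < 1 / 2 → ∃ f : ℝ → ℝ, HasSpectralDensity P X f ∧
    SpectralExpansion f (-2 * d) β c₀ c₁) ∧
  (1 / 2 ≤ d → ∃ f : ℝ → ℝ, HasSpectralDensity P (fun t ω ↦ X t ω - X (t - 1) ω) f ∧
    SpectralExpansion f (2 - 2 * d) β c₀ c₁)

/-- `∑_{t=k+1}^{k+ℓ} x_{t+ℓ} - ∑_{t=k+1}^{k+ℓ} x_t`. -/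
def blockIncrement (x : ℤ → ℝ) (k ℓ : ℤ) : ℝ :=
  ∑ t ∈ Finset.Icc (k + 1) (k + ℓ), x (t + ℓ) - ∑ t ∈ Finset.Icc (k + 1) (k + ℓ), x t

/-- The increment ratio statistic `IR_N(ℓ)` of the path `x₁, …, x_N` (meaningful for `3ℓ < N`). -/
def incrementRatio (x : ℤ → ℝ) (N ℓ : ℕ) : ℝ :=
  1 / ((N : ℝ) - 3 * (ℓ : ℝ)) * ∑ k ∈ Finset.range (N - 3 * ℓ),
    |blockIncrement x k ℓ + blockIncrement x (k + ℓ) ℓ| /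
      (|blockIncrement x k ℓ| + |blockIncrement x (k + ℓ) ℓ|)

/-- The function `Λ`. -/
def irLambda (r : ℝ) : ℝ :=
  2 / Real.pi * Real.arctan (Real.sqrt ((1 + r) / (1 - r))) +
    1 / Real.pi * Real.sqrt ((1 + r) / (1 - r)) * Real.log (2 / (1 + r))

/-- The function `ρ` on `[1/2, 3/2)`. -/
def irRho (d : ℝ) : ℝ :=
  if d = 1 / 2 then 9 * Real.log 3 / (8 * Real.log 2) - 2
  else ((4 : ℝ) ^ (d + 3 / 2) - (9 : ℝ) ^ (d + 1 / 2) - 7) / (2 * (4 - (4 : ℝ) ^ (d + 1 / 2)))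

/-- `Λ₀(d) = Λ(ρ(d))`. -/
def irLambda₀ (d : ℝ) : ℝ := irLambda (irRho d)

/-- The relative second order coefficient: `c₁ / c₀` for `β < 2`, and `c₁ / c₀ + 1 / 6` for `β = 2`
(the `x²/6` term of `sin(x/2)⁻⁴ = 16 x⁻⁴ (1 + x²/6 + …)` then has the same order). -/
def secondOrderCoeff (β c₀ c₁ : ℝ) : ℝ := c₁ / c₀ + if β = 2 then 1 / 6 else 0

end

/-! For a centered Gaussian pair with equal variances and correlation `r`, sum and difference are
independent. Since `|x| + |y| = max |x + y| |x - y|`, the ratio is a function of these two that is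
homogeneous of degree zero, and polar coordinates give its mean `Λ(r)` (`integral_gaussian_ratio`).
The block increments are stationary, so the mean of the statistic is exactly `Λ(C_m / V_m)`, with
`V_m` the block variance and `C_m` the covariance at lag `m`. It does not depend on `N`, whence the
uniformity.

Each block increment is a double sum of the increments of `X`, so `V_m` and `C_m` are integrals of
`f(x) sin⁴(mx/2) / sin⁴(x/2)`, with an extra `cos(mx)` for `C_m`. Expanding `f(x) / sin⁴(x/2)` at
the origin and rescaling by `m` gives, up to the common factor `32 c₀ m^p` with `p = 1 + 2d`, the
moment of order `p` plus `θ m^(-β)` times the moment of order `p - β`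
(`exists_spectralMoment_rate`). If `p = β = 2` the second moment diverges logarithmically, at the
rate of the mean value of the weight.

The ratio of the two moments of order `q` is `secantRatio q - 2` (`covMoment_add_two_mul`): `k² (1 -
cos x) - (1 - cos kx)` yields both weights, for `k = 2` and `k = 3`, and its moments follow from
scaling. The first-order change of the correlation is thus a positive multiple of `θ (secantRatio (p
- β) - secantRatio p)`. Strict convexity of `u ↦ u ^ (log 3 / log 2)` makes the secant slopes
strictly increasing (`strictMono_secantRatio`), and `Λ' > 0` (`exists_hasDerivAt_irLambda`), so `K ≠
0`. -/

/-! ### Mean ratio of a Gaussian pair. -/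

theorem abs_add_abs_eq_max_abs (x y : ℝ) : |x| + |y| = max |x + y| |x - y| := by
  rcases abs_cases x with ⟨h1, h1'⟩ | ⟨h1, h1'⟩ <;> rcases abs_cases y with ⟨h2, h2'⟩ | ⟨h2, h2'⟩ <;>
  rcases abs_cases (x + y) with ⟨h3, h3'⟩ | ⟨h3, h3'⟩ <;>
  rcases abs_cases (x - y) with ⟨h4, h4'⟩ | ⟨h4, h4'⟩ <;>
  rcases max_cases |x + y| |x - y| with ⟨h5, h5'⟩ | ⟨h5, h5'⟩ <;> linarith

theorem integral_Ioi_mul_exp_neg_sq_div_two :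
    ∫ r in Set.Ioi (0 : ℝ), r * Real.exp (-(r ^ 2) / 2) = 1 := by
  have h := integral_rpow_mul_exp_neg_mul_rpow (p := 2) (q := 1) (b := 1 / 2) (by norm_num)
    (by norm_num) (by norm_num)
  have h2 : (-(1 + 1) / 2 : ℝ) = -1 := by norm_num
  have h3 : ((1 + 1) / 2 : ℝ) = 1 := by norm_num
  rw [h2, h3, Real.Gamma_one, Real.rpow_neg_one] at h
  norm_num at h
  rw [← h]
  refine integral_congr_ae (Eventually.of_forall fun r ↦ ?_)
  simp only
  congr 2
  ring

theorem gaussianReal_prod_self :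
    (gaussianReal 0 1).prod (gaussianReal 0 1) =
      (volume : Measure (ℝ × ℝ)).withDensity
        (fun z ↦ ENNReal.ofReal ((2 * Real.pi)⁻¹ * Real.exp (-(z.1 ^ 2 + z.2 ^ 2) / 2))) := by
  rw [gaussianReal_of_var_ne_zero _ one_ne_zero, prod_withDensity (by fun_prop) (by fun_prop)]
  congr 1
  ext z
  simp only [gaussianPDF, gaussianPDFReal]
  rw [← ENNReal.ofReal_mul (by positivity)]
  congr 1
  simp only [NNReal.coe_one, mul_one, sub_zero]
  rw [mul_mul_mul_comm, ← mul_inv, Real.mul_self_sqrt (by positivity), ← Real.exp_add]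
  congr 2
  ring

/-- In polar coordinates the density depends on the radius only and `h` on the angle only; the
radial factor integrates to `1`. No regularity of `h` is needed, because the product formula also
holds for the default value of a divergent integral. -/
theorem integral_gaussianReal_prod_of_homogeneous (h : ℝ × ℝ → ℝ)
    (hh : ∀ r > 0, ∀ z : ℝ × ℝ, h (r * z.1, r * z.2) = h z) :
    ∫ z, h z ∂((gaussianReal 0 1).prod (gaussianReal 0 1)) =
      (2 * Real.pi)⁻¹ * ∫ θ in (-Real.pi)..Real.pi, h (Real.cos θ, Real.sin θ) := by
  rw [gaussianReal_prod_self, integral_withDensity_eq_integral_toReal_smul (by fun_prop) (by simp),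
    ← integral_comp_polarCoord_symm]
  have h1 : ∀ p ∈ polarCoord.target, p.1 • ((ENNReal.ofReal ((2 * Real.pi)⁻¹ *
      Real.exp (-((polarCoord.symm p).1 ^ 2 + (polarCoord.symm p).2 ^ 2) / 2))).toReal •
        h (polarCoord.symm p)) = (p.1 * Real.exp (-(p.1 ^ 2) / 2)) *
          ((2 * Real.pi)⁻¹ * h (Real.cos p.2, Real.sin p.2)) := by
    rintro ⟨r, θ⟩ hp
    simp only [polarCoord_target, Set.mem_prod, Set.mem_Ioi] at hp
    rw [ENNReal.toReal_ofReal (by positivity)]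
    simp only [polarCoord_symm_apply, smul_eq_mul]
    rw [hh r hp.1 (Real.cos θ, Real.sin θ)]
    have : (r * Real.cos θ) ^ 2 + (r * Real.sin θ) ^ 2 = r ^ 2 := by
      have := Real.sin_sq_add_cos_sq θ
      linear_combination r ^ 2 * this
    rw [this]; ring
  rw [setIntegral_congr_fun polarCoord.open_target.measurableSet h1, polarCoord_target,
    Measure.volume_eq_prod, setIntegral_prod_mul (fun r : ℝ ↦ r * Real.exp (-(r ^ 2) / 2))
      (fun θ ↦ (2 * Real.pi)⁻¹ * h (Real.cos θ, Real.sin θ)),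
    integral_Ioi_mul_exp_neg_sq_div_two, one_mul, integral_const_mul,
    intervalIntegral.integral_of_le (by linarith [Real.pi_pos]), integral_Ioc_eq_integral_Ioo]

theorem abs_div_max_abs_le_one (a b : ℝ) : |(|a| / max |a| |b|)| ≤ 1 := by
  rw [abs_of_nonneg (by positivity)]
  exact div_le_one_of_le₀ (le_max_left _ _) (by positivity)

theorem intervalIntegrable_ratio_polar (s a b : ℝ) :
    IntervalIntegrable (fun θ ↦ |s * Real.cos θ| / max |s * Real.cos θ| |Real.sin θ|) volume a b := by
  refine (intervalIntegrable_const (c := (1 : ℝ))).mono_fun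
    (Measurable.aestronglyMeasurable (by fun_prop)) (Eventually.of_forall fun θ ↦ ?_)
  rw [norm_one]
  exact abs_div_max_abs_le_one (s * Real.cos θ) (Real.sin θ)

/-- The maximum switches at `θ = arctan s`: the integrand is `1` before that angle and `s cot θ`
after it, with primitive `s log sin θ`. -/
theorem integral_ratio_polar_Icc {s : ℝ} (hs : 0 < s) :
    ∫ θ in (0 : ℝ)..(Real.pi / 2), |s * Real.cos θ| / max |s * Real.cos θ| |Real.sin θ| =
      Real.arctan s + s / 2 * Real.log (1 + (s ^ 2)⁻¹) := by
  have hpi := Real.pi_pos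
  have ha0 : 0 < Real.arctan s := Real.arctan_pos.2 hs
  have ha1 : Real.arctan s < Real.pi / 2 := Real.arctan_lt_pi_div_two s
  rw [← intervalIntegral.integral_add_adjacent_intervals (b := Real.arctan s)
    (intervalIntegrable_ratio_polar s _ _) (intervalIntegrable_ratio_polar s _ _)]
  have htan : ∀ θ, 0 ≤ θ → θ < Real.pi / 2 → 0 < Real.cos θ ∧ 0 ≤ Real.sin θ ∧
      Real.sin θ = Real.tan θ * Real.cos θ := fun θ h0 h1 ↦ by
    have hc := Real.cos_pos_of_mem_Ioo ⟨by linarith, h1⟩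
    exact ⟨hc, Real.sin_nonneg_of_nonneg_of_le_pi h0 (by linarith),
      (Real.tan_mul_cos hc.ne').symm⟩
  congr 1
  · trans ∫ θ in (0 : ℝ)..(Real.arctan s), (1 : ℝ)
    · refine intervalIntegral.integral_congr fun θ hθ ↦ ?_
      rw [Set.uIcc_of_le ha0.le] at hθ
      obtain ⟨hc, hs', ht⟩ := htan θ hθ.1 (hθ.2.trans_lt ha1)
      have h1 : Real.tan θ ≤ s := by
        rw [← Real.tan_arctan s]
        exact Real.strictMonoOn_tan.monotoneOn ⟨by linarith [hθ.1], hθ.2.trans_lt ha1⟩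
          ⟨by linarith, ha1⟩ hθ.2
      have h2 : |Real.sin θ| ≤ |s * Real.cos θ| := by
        rw [abs_of_nonneg hs', abs_of_pos (mul_pos hs hc), ht]
        gcongr
      rw [max_eq_left h2, div_self (abs_pos.2 (mul_pos hs hc).ne').ne']
    · simp
  · have hsin : ∀ θ ∈ Set.uIcc (Real.arctan s) (Real.pi / 2), 0 < Real.sin θ := fun θ hθ ↦ by
      rw [Set.uIcc_of_le ha1.le] at hθ
      exact Real.sin_pos_of_pos_of_lt_pi (by linarith [hθ.1]) (by linarith [hθ.2])
    have hder : ∀ θ ∈ Set.uIcc (Real.arctan s) (Real.pi / 2),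
        HasDerivAt (fun θ ↦ s * Real.log (Real.sin θ)) (s * (Real.cos θ / Real.sin θ)) θ :=
      fun θ hθ ↦ ((Real.hasDerivAt_sin θ).log (hsin θ hθ).ne').const_mul s
    trans ∫ θ in (Real.arctan s)..(Real.pi / 2), s * (Real.cos θ / Real.sin θ)
    · refine intervalIntegral.integral_congr fun θ hθ ↦ ?_
      have hsp := hsin θ hθ
      rw [Set.uIcc_of_le ha1.le] at hθ
      have hc : 0 ≤ Real.cos θ := Real.cos_nonneg_of_mem_Icc ⟨by linarith [hθ.1], hθ.2⟩
      have h2 : |s * Real.cos θ| ≤ |Real.sin θ| := by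
        rw [abs_of_pos hsp, abs_of_nonneg (mul_nonneg hs.le hc)]
        rcases hθ.2.eq_or_lt with h | h
        · rw [h]; simp
        · obtain ⟨hc, hs', ht⟩ := htan θ (by linarith [hθ.1]) h
          rw [ht]
          gcongr
          rw [← Real.tan_arctan s]
          exact Real.strictMonoOn_tan.monotoneOn ⟨by linarith, ha1⟩ ⟨by linarith [hθ.1], h⟩ hθ.1
      rw [max_eq_right h2, abs_of_pos hsp, abs_of_nonneg (mul_nonneg hs.le hc), mul_div_assoc]
    · rw [intervalIntegral.integral_eq_sub_of_hasDerivAt hder]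
      · rw [Real.sin_pi_div_two, Real.log_one, Real.sin_arctan,
          Real.log_div hs.ne' (by positivity), Real.log_sqrt (by positivity)]
        have : 1 + (s ^ 2)⁻¹ = (1 + s ^ 2) / s ^ 2 := by field_simp; ring
        rw [this, Real.log_div (by positivity) (by positivity), Real.log_pow]
        push_cast; ring
      · refine ContinuousOn.intervalIntegrable ?_
        exact continuousOn_const.mul (Real.continuous_cos.continuousOn.div
          Real.continuous_sin.continuousOn fun θ hθ ↦ (hsin θ hθ).ne')

theorem integral_ratio_polar {s : ℝ} (hs : 0 < s) :
    ∫ θ in (-Real.pi)..Real.pi, |s * Real.cos θ| / max |s * Real.cos θ| |Real.sin θ| =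
      4 * (Real.arctan s + s / 2 * Real.log (1 + (s ^ 2)⁻¹)) := by
  set F : ℝ → ℝ := fun θ ↦ |s * Real.cos θ| / max |s * Real.cos θ| |Real.sin θ| with hF
  have hint : ∀ a b, IntervalIntegrable F volume a b := intervalIntegrable_ratio_polar s
  have h1 : ∀ θ, F (-θ) = F θ := fun θ ↦ by simp [hF]
  have h2 : ∀ θ, F (Real.pi - θ) = F θ := fun θ ↦ by simp [hF]
  rw [← intervalIntegral.integral_add_adjacent_intervals (hint _ 0) (hint 0 _),
    ← intervalIntegral.integral_add_adjacent_intervals (hint 0 (Real.pi / 2)) (hint _ Real.pi)]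
  have h3 : ∫ θ in (-Real.pi)..0, F θ = ∫ θ in (0 : ℝ)..Real.pi, F θ := by
    have := intervalIntegral.integral_comp_neg F (a := 0) (b := Real.pi)
    simp only [h1, neg_zero] at this
    exact this.symm
  have h4 : ∫ θ in (Real.pi / 2)..Real.pi, F θ = ∫ θ in (0 : ℝ)..(Real.pi / 2), F θ := by
    have := intervalIntegral.integral_comp_sub_left F (a := 0) (b := Real.pi / 2) Real.pi
    simp only [h2, sub_zero] at this
    rw [this]; congr 1; ring
  rw [h3, ← intervalIntegral.integral_add_adjacent_intervals (hint 0 (Real.pi / 2))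
    (hint _ Real.pi), h4, integral_ratio_polar_Icc hs]
  ring

theorem irLambda_eq {r : ℝ} (h1 : -1 < r) (h2 : r < 1) :
    irLambda r = (2 * Real.pi)⁻¹ * (4 * (Real.arctan √((1 + r) / (1 - r)) +
      √((1 + r) / (1 - r)) / 2 * Real.log (1 + (√((1 + r) / (1 - r)) ^ 2)⁻¹))) := by
  have h3 : 0 < 1 + r := by linarith
  have h4 : 0 < 1 - r := by linarith
  rw [Real.sq_sqrt (by positivity), irLambda]
  have : 1 + ((1 + r) / (1 - r))⁻¹ = 2 / (1 + r) := by field_simp; ring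
  rw [this]
  have := Real.pi_pos.ne'
  field_simp
  ring

/-- The mean increment ratio of a centered Gaussian pair with equal variances. -/
theorem integral_gaussian_ratio {Ω : Type*} [MeasurableSpace Ω] {P : Measure Ω}
    [IsProbabilityMeasure P] {D E : Ω → ℝ} (hDE : HasGaussianLaw (fun ω ↦ (D ω, E ω)) P)
    (hD : ∫ ω, D ω ∂P = 0) (hE : ∫ ω, E ω ∂P = 0) {V C : ℝ}
    (hVD : cov[D, D; P] = V) (hVE : cov[E, E; P] = V) (hC : cov[D, E; P] = C)
    (h1 : -V < C) (h2 : C < V) :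
    ∫ ω, |D ω + E ω| / (|D ω| + |E ω|) ∂P = irLambda (C / V) := by
  have hV : 0 < V := by linarith
  have hDL := hDE.fst.memLp_two
  have hEL := hDE.snd.memLp_two
  set a := √(2 * (V + C)) with ha
  set b := √(2 * (V - C)) with hb
  have ha0 : 0 < a := Real.sqrt_pos.2 (by linarith)
  have hb0 : 0 < b := Real.sqrt_pos.2 (by linarith)
  have ha2 : a ^ 2 = 2 * (V + C) := Real.sq_sqrt (by linarith)
  have hb2 : b ^ 2 = 2 * (V - C) := Real.sq_sqrt (by linarith)
  -- `a²` and `b²` are the variances of `D + E` and `D - E`. These two are uncorrelated because `D`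
  -- and `E` have equal variances, hence independent by joint Gaussianity.
  set Y : Ω → ℝ := fun ω ↦ a⁻¹ * (D + E) ω with hY
  set Z : Ω → ℝ := fun ω ↦ b⁻¹ * (D - E) ω with hZ
  have hYZ : HasGaussianLaw (fun ω ↦ (Y ω, Z ω)) P := by
    let L : ℝ × ℝ →L[ℝ] ℝ × ℝ :=
      (a⁻¹ • (ContinuousLinearMap.fst ℝ ℝ ℝ + ContinuousLinearMap.snd ℝ ℝ ℝ)).prod
        (b⁻¹ • (ContinuousLinearMap.fst ℝ ℝ ℝ - ContinuousLinearMap.snd ℝ ℝ ℝ))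
    exact hDE.map_fun L
  have hED : cov[E, D; P] = C := by rw [covariance_comm, hC]
  have hcov : cov[Y, Z; P] = 0 := by
    rw [hY, hZ, covariance_const_mul_left, covariance_const_mul_right,
      covariance_sub_right (hDL.add hEL) hDL hEL, covariance_add_left hDL hEL hDL,
      covariance_add_left hDL hEL hEL, hVD, hVE, hC, hED]
    ring
  have hvY : Var[Y; P] = 1 := by
    rw [← covariance_self hYZ.fst.aemeasurable, hY, covariance_const_mul_left,
      covariance_const_mul_right,
      covariance_add_right (hDL.add hEL) hDL hEL, covariance_add_left hDL hEL hDL,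
      covariance_add_left hDL hEL hEL, hVD, hVE, hC, hED]
    field_simp
    rw [ha2]; ring
  have hvZ : Var[Z; P] = 1 := by
    rw [← covariance_self hYZ.snd.aemeasurable, hZ, covariance_const_mul_left,
      covariance_const_mul_right,
      covariance_sub_right (hDL.sub hEL) hDL hEL, covariance_sub_left hDL hEL hDL,
      covariance_sub_left hDL hEL hEL, hVD, hVE, hC, hED]
    field_simp
    rw [hb2]; ring
  have hDI := hDE.fst.integrable
  have hEI := hDE.snd.integrable
  have hmY : P[Y] = 0 := by
    simp only [hY, Pi.add_apply]
    rw [integral_const_mul, integral_add hDI hEI, hD, hE]; simp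
  have hmZ : P[Z] = 0 := by
    simp only [hZ, Pi.sub_apply]
    rw [integral_const_mul, integral_sub hDI hEI, hD, hE]; simp
  have hind : IndepFun Y Z P := hYZ.indepFun_of_covariance_eq_zero hcov
  have hlaw : P.map (fun ω ↦ (Y ω, Z ω)) = (gaussianReal 0 1).prod (gaussianReal 0 1) := by
    rw [(indepFun_iff_map_prod_eq_prod_map_map hYZ.fst.aemeasurable hYZ.snd.aemeasurable).1 hind,
      hYZ.fst.map_eq_gaussianReal, hYZ.snd.map_eq_gaussianReal, hvY, hvZ, hmY, hmZ, Real.toNNReal_one]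
  set s := a / b with hs
  have hs0 : 0 < s := div_pos ha0 hb0
  -- The ratio `|D + E| / max |D + E| |D - E|` written in the normalized variables, after dividing
  -- through by `b`.
  set h : ℝ × ℝ → ℝ := fun z ↦ |s * z.1| / max |s * z.1| |z.2| with hh
  have hhm : Measurable h := by fun_prop
  have hpt : ∀ ω, |D ω + E ω| / (|D ω| + |E ω|) = h (Y ω, Z ω) := fun ω ↦ by
    have e1 : |s * Y ω| = b⁻¹ * |D ω + E ω| := by
      have : s * Y ω = b⁻¹ * (D ω + E ω) := by
        simp only [hY, hs, Pi.add_apply]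
        field_simp
      rw [this, abs_mul, abs_of_pos (inv_pos.2 hb0)]
    have e2 : |Z ω| = b⁻¹ * |D ω - E ω| := by
      simp only [hZ, Pi.sub_apply]
      rw [abs_mul, abs_of_pos (inv_pos.2 hb0)]
    rw [abs_add_abs_eq_max_abs, hh]
    simp only
    rw [e1, e2, ← mul_max_of_nonneg _ _ (inv_pos.2 hb0).le,
      mul_div_mul_left _ _ (inv_pos.2 hb0).ne']
  simp_rw [hpt]
  rw [← integral_map (φ := fun ω ↦ (Y ω, Z ω)) hYZ.aemeasurable hhm.aestronglyMeasurable, hlaw,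
    integral_gaussianReal_prod_of_homogeneous, integral_ratio_polar hs0, irLambda_eq]
  · have : s = √((1 + C / V) / (1 - C / V)) := by
      rw [hs, ha, hb, ← Real.sqrt_div (by linarith)]
      congr 1
      have : V - C ≠ 0 := by linarith
      have : V + C ≠ 0 := by linarith
      field_simp
    rw [this]
  · rw [lt_div_iff₀ hV]; linarith
  · rw [div_lt_one hV]; exact h2
  · intro r hr z
    simp only [hh]
    have e1 : |s * (r * z.1)| = r * |s * z.1| := by
      rw [← abs_of_pos hr, ← abs_mul, abs_of_pos hr]; congr 1; ring
    rw [e1, abs_mul r, abs_of_pos hr, ← mul_max_of_nonneg _ _ hr.le, mul_div_mul_left _ _ hr.ne']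

/-! ### Block increments as double sums, and their spectral covariances. -/

theorem Int.sum_Icc_add_one (f : ℤ → ℝ) (k : ℤ) (m : ℕ) :
    ∑ t ∈ Finset.Icc (k + 1) (k + m), f t = ∑ i ∈ Finset.range m, f (k + 1 + i) := by
  refine Finset.sum_nbij' (fun t ↦ (t - k - 1).toNat) (fun i ↦ k + 1 + i) ?_ ?_ ?_ ?_ ?_
  · intro t ht; simp only [Finset.mem_Icc, Finset.mem_range] at *; omega
  · intro t ht; simp only [Finset.mem_Icc, Finset.mem_range] at *; omega
  · intro t ht; simp only [Finset.mem_Icc] at *; omega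
  · intro t ht; omega
  · intro t ht; simp only [Finset.mem_Icc] at *; congr 1; omega

/-- Each difference at distance `m` telescopes into `m` unit increments. The offset is `k + 2`
because both indices start at `0` and the first unit increment ends at `k + 2`. -/
theorem blockIncrement_eq_sum_increments (x : ℤ → ℝ) (k : ℤ) (m : ℕ) :
    blockIncrement x k m = ∑ p ∈ Finset.range m ×ˢ Finset.range m,
      (x (k + 2 + (p.1 + p.2)) - x (k + 2 + (p.1 + p.2) - 1)) := by
  rw [blockIncrement, ← Finset.sum_sub_distrib, Int.sum_Icc_add_one, Finset.sum_product]
  refine Finset.sum_congr rfl fun i _ ↦ ?_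
  have := Finset.sum_range_sub (fun j : ℕ ↦ x (k + 1 + i + j)) m
  simp only [Nat.cast_zero, add_zero] at this
  rw [← this]
  refine Finset.sum_congr rfl fun j _ ↦ ?_
  congr 2 <;> push_cast <;> ring

/-- The exponential sum `∑_{j < m} e^{ijx}`. -/
noncomputable def expSum (m : ℕ) (x : ℝ) : ℂ := ∑ j ∈ Finset.range m, Complex.exp (Complex.I * (j : ℂ) * x)

theorem continuous_expSum (m : ℕ) : Continuous (expSum m) := by
  unfold expSum; fun_prop

theorem norm_exp_I_mul_sub_one_sq (x : ℝ) :
    ‖Complex.exp (Complex.I * x) - 1‖ ^ 2 = 4 * Real.sin (x / 2) ^ 2 := by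
  rw [Complex.norm_exp_I_mul_ofReal_sub_one, Real.norm_eq_abs, sq_abs]
  ring

theorem norm_expSum_pow_four (m : ℕ) {x : ℝ} (hx : Real.sin (x / 2) ≠ 0) :
    ‖expSum m x‖ ^ 4 = Real.sin (m * x / 2) ^ 4 / Real.sin (x / 2) ^ 4 := by
  have h : expSum m x * (Complex.exp (Complex.I * x) - 1) =
      Complex.exp (Complex.I * ((m * x : ℝ) : ℂ)) - 1 := by
    have := geom_sum_mul (Complex.exp (Complex.I * x)) m
    rw [← Complex.exp_nat_mul] at this
    convert this using 2
    · refine Finset.sum_congr rfl fun j _ ↦ ?_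
      rw [← Complex.exp_nat_mul]; congr 1; ring
    · congr 1; push_cast; ring
  have h2 : ‖expSum m x‖ ^ 2 * (4 * Real.sin (x / 2) ^ 2) = 4 * Real.sin (m * x / 2) ^ 2 := by
    rw [← norm_exp_I_mul_sub_one_sq, ← norm_exp_I_mul_sub_one_sq, ← mul_pow, ← norm_mul, h]
  rw [eq_div_iff (by positivity)]
  -- Squares `h2` through `A² - B² = (A + B)(A - B)`.
  linear_combination (‖expSum m x‖ ^ 2 * Real.sin (x / 2) ^ 2 + Real.sin (m * x / 2) ^ 2) / 4 * h2

section Spectral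
variable {Ω : Type*} [MeasurableSpace Ω] {P : Measure Ω}
  {U : ℤ → Ω → ℝ} {f : ℝ → ℝ}

theorem HasSpectralDensity.intervalIntegrable (h : HasSpectralDensity P U f) :
    IntervalIntegrable f volume (-Real.pi) Real.pi := by
  rw [intervalIntegrable_iff_integrableOn_Icc_of_le (by linarith [Real.pi_pos])]
  exact h.integrableOn

theorem HasSpectralDensity.intervalIntegrable_mul (h : HasSpectralDensity P U f) {g : ℝ → ℂ}
    (hg : Continuous g) :
    IntervalIntegrable (fun x ↦ g x * (f x : ℂ)) volume (-Real.pi) Real.pi :=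
  by
  have : IntervalIntegrable (fun x ↦ (f x : ℂ)) volume (-Real.pi) Real.pi :=
    ⟨h.intervalIntegrable.1.ofReal, h.intervalIntegrable.2.ofReal⟩
  exact this.continuousOn_mul hg.continuousOn

variable [IsProbabilityMeasure P]

theorem HasSpectralDensity.covariance_sum_sum (h : HasSpectralDensity P U f) {ι : Type*}
    (s t : Finset ι) (n n' : ι → ℤ) :
    ((covariance (fun ω ↦ ∑ i ∈ s, U (n i) ω) (fun ω ↦ ∑ i ∈ t, U (n' i) ω) P : ℝ) : ℂ) =
      ∫ x in (-Real.pi)..Real.pi, (∑ i ∈ s, Complex.exp (Complex.I * (n i : ℂ) * (x : ℂ))) *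
        (∑ i ∈ t, Complex.exp (-(Complex.I * (n' i : ℂ) * (x : ℂ)))) * (f x : ℂ) := by
  rw [covariance_fun_sum_fun_sum' (fun i _ ↦ h.memLp _) (fun i _ ↦ h.memLp _)]
  simp_rw [Finset.sum_mul_sum, Finset.sum_mul]
  rw [intervalIntegral.integral_finsetSum]
  · push_cast
    refine Finset.sum_congr rfl fun i _ ↦ ?_
    rw [intervalIntegral.integral_finsetSum]
    · refine Finset.sum_congr rfl fun j _ ↦ ?_
      have := h.covariance_eq (n' j) (n i - n' j)
      rw [add_sub_cancel] at this
      rw [this]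
      refine intervalIntegral.integral_congr fun x _ ↦ ?_
      rw [← Complex.exp_add]
      congr 2
      push_cast; ring
    · exact fun j _ ↦ h.intervalIntegrable_mul (by fun_prop)
  · intro i _
    have := h.intervalIntegrable_mul (g := fun x : ℝ ↦ ∑ j ∈ t,
      Complex.exp (Complex.I * (n i : ℂ) * (x : ℂ)) *
        Complex.exp (-(Complex.I * (n' j : ℂ) * (x : ℂ)))) (by fun_prop)
    simpa only [Finset.sum_mul] using this

theorem sum_exp_product (k : ℤ) (m : ℕ) (x : ℝ) :
    ∑ p ∈ Finset.range m ×ˢ Finset.range m,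
      Complex.exp (Complex.I * ((k + 2 + ((p.1 : ℤ) + (p.2 : ℤ)) : ℤ) : ℂ) * (x : ℂ)) =
    Complex.exp (Complex.I * ((k + 2 : ℤ) : ℂ) * (x : ℂ)) * expSum m x ^ 2 := by
  rw [expSum, sq, Finset.sum_mul_sum, Finset.sum_product, Finset.mul_sum]
  refine Finset.sum_congr rfl fun i _ ↦ ?_
  rw [Finset.mul_sum]
  refine Finset.sum_congr rfl fun j _ ↦ ?_
  rw [← Complex.exp_add, ← Complex.exp_add]
  congr 1; push_cast; ring

/-- The exponential sum over the square of indices is a phase times `expSum m x ^ 2`, and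
multiplying by a conjugate leaves the fourth power of the modulus. The covariance is real, so taking
real parts turns the remaining phase into a cosine. -/
theorem HasSpectralDensity.covariance_blockSum (h : HasSpectralDensity P U f) (k l : ℤ) (m : ℕ) :
    covariance (fun ω ↦ ∑ p ∈ Finset.range m ×ˢ Finset.range m, U (k + 2 + (p.1 + p.2)) ω)
      (fun ω ↦ ∑ p ∈ Finset.range m ×ˢ Finset.range m, U (l + 2 + (p.1 + p.2)) ω) P =
    ∫ x in (-Real.pi)..Real.pi, Real.cos ((k - l) * x) * ‖expSum m x‖ ^ 4 * f x := by
  have h1 := h.covariance_sum_sum (Finset.range m ×ˢ Finset.range m)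
    (Finset.range m ×ˢ Finset.range m) (fun p : ℕ × ℕ ↦ k + 2 + ((p.1 : ℤ) + (p.2 : ℤ)))
    (fun p : ℕ × ℕ ↦ l + 2 + ((p.1 : ℤ) + (p.2 : ℤ)))
  have h2 : ∀ x : ℝ, (∑ p ∈ Finset.range m ×ˢ Finset.range m,
      Complex.exp (Complex.I * ((k + 2 + ((p.1 : ℤ) + (p.2 : ℤ)) : ℤ) : ℂ) * (x : ℂ))) *
      (∑ p ∈ Finset.range m ×ˢ Finset.range m,
      Complex.exp (-(Complex.I * ((l + 2 + ((p.1 : ℤ) + (p.2 : ℤ)) : ℤ) : ℂ) * (x : ℂ)))) * (f x : ℂ)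
      = Complex.exp ((((k - l) * x : ℝ) : ℂ) * Complex.I) * ((‖expSum m x‖ ^ 4 : ℝ) : ℂ) *
        (f x : ℂ) := fun x ↦ by
    have e1 := congrArg (starRingEnd ℂ) (sum_exp_product l m x)
    simp only [map_sum, ← Complex.exp_conj, map_mul, Complex.conj_I, Complex.conj_ofReal, map_pow,
      map_intCast, neg_mul] at e1
    rw [e1, sum_exp_product]
    have e2 : expSum m x * (starRingEnd ℂ) (expSum m x) = ((‖expSum m x‖ ^ 2 : ℝ) : ℂ) := by
      rw [Complex.mul_conj, Complex.normSq_eq_norm_sq]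
    have e3 : Complex.exp ((((k - l) * x : ℝ) : ℂ) * Complex.I) =
        Complex.exp (Complex.I * ((k + 2 : ℤ) : ℂ) * (x : ℂ)) *
          Complex.exp (-(Complex.I * ((l + 2 : ℤ) : ℂ) * (x : ℂ))) := by
      rw [← Complex.exp_add]; congr 1; push_cast; ring
    have e4 : ((‖expSum m x‖ ^ 4 : ℝ) : ℂ) = ((‖expSum m x‖ ^ 2 : ℝ) : ℂ) ^ 2 := by
      push_cast; ring
    rw [e3, e4, ← e2]
    ring
  simp only [h2] at h1
  have hint := h.intervalIntegrable_mul (g := fun x : ℝ ↦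
    Complex.exp ((((k - l) * x : ℝ) : ℂ) * Complex.I) * ((‖expSum m x‖ ^ 4 : ℝ) : ℂ)) (by
      have := continuous_expSum m
      fun_prop)
  have h3 := Complex.reCLM.intervalIntegral_comp_comm hint
  rw [← h1] at h3
  simp only [Complex.reCLM_apply, Complex.ofReal_re] at h3
  rw [← h3]
  refine intervalIntegral.integral_congr fun x _ ↦ ?_
  rw [Complex.re_mul_ofReal, Complex.re_mul_ofReal, Complex.exp_ofReal_mul_I_re]

end Spectral

/-! ### Mellin moments of the two weights and their ratio. -/

theorem integrableOn_Ioi_rpow_mul {g : ℝ → ℝ} (hg : Continuous g) {a b q C C' : ℝ} (ha : a < q)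
    (hb : q < b) (h0 : ∀ x, 0 < x → x ≤ 1 → |g x| ≤ C * x ^ b)
    (h1 : ∀ x, 1 ≤ x → |g x| ≤ C' * x ^ a) :
    IntegrableOn (fun x ↦ x ^ (-q - 1) * g x) (Set.Ioi 0) := by
  refine mellin_convergent_of_isBigO_scalar (a := -a) (b := -b)
    (hg.locallyIntegrable.locallyIntegrableOn _) ?_ (by linarith) ?_ (by linarith)
  · refine Asymptotics.IsBigO.of_bound C' ?_
    filter_upwards [eventually_ge_atTop 1] with x hx
    rw [neg_neg, Real.norm_eq_abs, Real.norm_eq_abs, abs_of_nonneg (Real.rpow_nonneg (by linarith) _)]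
    exact h1 x hx
  · refine Asymptotics.IsBigO.of_bound C ?_
    filter_upwards [Ioc_mem_nhdsGT (zero_lt_one (α := ℝ))] with x hx
    rw [neg_neg, Real.norm_eq_abs, Real.norm_eq_abs, abs_of_nonneg (Real.rpow_nonneg hx.1.le _)]
    exact h0 x hx.1 hx.2

/-- The moment `∫₀^∞ x^{-q-1} g(x) dx`. -/
noncomputable def halfMoment (g : ℝ → ℝ) (q : ℝ) : ℝ := ∫ x in Set.Ioi (0 : ℝ), x ^ (-q - 1) * g x

theorem halfMoment_comp_mul_left (g : ℝ → ℝ) (q : ℝ) {k : ℝ} (hk : 0 < k) :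
    halfMoment (fun x ↦ g (k * x)) q = k ^ q * halfMoment g q := by
  have h := integral_comp_mul_left_Ioi' (fun x ↦ x ^ (-q - 1) * g x) 0 hk
  rw [mul_zero] at h
  rw [halfMoment, halfMoment, ← h, smul_eq_mul, ← mul_assoc, ← integral_const_mul]
  refine setIntegral_congr_fun measurableSet_Ioi fun x hx ↦ ?_
  have hx' : 0 < x := hx
  rw [Real.mul_rpow hk.le hx'.le]
  have : k ^ q * k * k ^ (-q - 1) = 1 := by
    rw [← Real.rpow_add_one hk.ne', ← Real.rpow_add hk]; simp
  linear_combination -(x ^ (-q - 1) * g (k * x)) * this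

theorem integrableOn_comp_mul_left {g : ℝ → ℝ} {q : ℝ}
    (hg : IntegrableOn (fun x ↦ x ^ (-q - 1) * g x) (Set.Ioi 0)) {k : ℝ} (hk : 0 < k) :
    IntegrableOn (fun x ↦ x ^ (-q - 1) * g (k * x)) (Set.Ioi 0) := by
  have h := (integrableOn_Ioi_comp_mul_left_iff (fun x ↦ x ^ (-q - 1) * g x) 0 hk).2
    (by rwa [mul_zero])
  refine IntegrableOn.congr_fun (h.const_mul (k ^ (q + 1))) (fun x hx ↦ ?_) measurableSet_Ioi
  have hx' : 0 < x := hx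
  rw [Real.mul_rpow hk.le hx'.le]
  have : k ^ (q + 1) * k ^ (-q - 1) = 1 := by
    rw [← Real.rpow_add hk]; simp
  linear_combination (x ^ (-q - 1) * g (k * x)) * this

/-- `k² (1 - cos x) - (1 - cos (k x))`. -/
noncomputable def cosDefect (k x : ℝ) : ℝ := k ^ 2 * (1 - Real.cos x) - (1 - Real.cos (k * x))

theorem one_sub_cos_le (x : ℝ) : 1 - Real.cos x ≤ x ^ 2 / 2 := by
  linarith [Real.one_sub_sq_div_two_le_cos (x := x)]

theorem integrableOn_one_sub_cos {q : ℝ} (h0 : 0 < q) (h2 : q < 2) :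
    IntegrableOn (fun x ↦ x ^ (-q - 1) * (1 - Real.cos x)) (Set.Ioi 0) := by
  refine integrableOn_Ioi_rpow_mul (a := 0) (b := 2) (C := 1 / 2) (C' := 2) (by fun_prop) h0 h2 ?_ ?_
  · intro x _ _
    rw [abs_of_nonneg (by linarith [Real.cos_le_one x]), Real.rpow_two]
    linarith [one_sub_cos_le x]
  · intro x _
    rw [abs_of_nonneg (by linarith [Real.cos_le_one x]), Real.rpow_zero]
    linarith [Real.neg_one_le_cos x]

theorem integrableOn_cos_remainder {q : ℝ} (h2 : 2 < q) (h4 : q < 4) :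
    IntegrableOn (fun x ↦ x ^ (-q - 1) * (x ^ 2 / 2 - (1 - Real.cos x))) (Set.Ioi 0) := by
  refine integrableOn_Ioi_rpow_mul (a := 2) (b := 4) (C := 5 / 96) (C' := 1 / 2) (by fun_prop)
    h2 h4 ?_ ?_
  · intro x h0 h1
    have := Real.cos_bound (x := x) (by rwa [abs_of_pos h0])
    rw [abs_of_pos h0] at this
    have e : (x : ℝ) ^ (4 : ℝ) = x ^ 4 := by exact_mod_cast Real.rpow_natCast x 4
    rw [e, mul_comm]
    convert this using 2
    ring
  · intro x _
    rw [abs_of_nonneg (by linarith [one_sub_cos_le x]), Real.rpow_two]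
    linarith [Real.cos_le_one x]

/-- For `q < 2` the two halves of the defect converge separately, and the substitution `x ↦ k x`
produces `k ^ q`. -/
theorem halfMoment_cosDefect_of_lt {q k : ℝ} (h0 : 0 < q) (h2 : q < 2) (hk : 0 < k) :
    halfMoment (cosDefect k) q = (k ^ 2 - k ^ q) * halfMoment (fun x ↦ 1 - Real.cos x) q := by
  have hi := integrableOn_one_sub_cos h0 h2
  have hik := integrableOn_comp_mul_left (g := fun x ↦ 1 - Real.cos x) hi hk
  have := halfMoment_comp_mul_left (fun x ↦ 1 - Real.cos x) q hk
  rw [sub_mul, ← this, halfMoment, halfMoment, halfMoment, ← integral_const_mul,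
    ← integral_sub (hi.const_mul _) hik]
  refine integral_congr_ae (Eventually.of_forall fun x ↦ ?_)
  simp only [cosDefect]; ring

/-- For `q > 2` the halves diverge at the origin. Subtracting the Taylor term `x²/2` from each
restores convergence, and the subtracted terms cancel in the defect. -/
theorem halfMoment_cosDefect_of_gt {q k : ℝ} (h2 : 2 < q) (h4 : q < 4) (hk : 0 < k) :
    halfMoment (cosDefect k) q =
      (k ^ q - k ^ 2) * halfMoment (fun x ↦ x ^ 2 / 2 - (1 - Real.cos x)) q := by
  have hi := integrableOn_cos_remainder h2 h4
  have hik := integrableOn_comp_mul_left (g := fun x ↦ x ^ 2 / 2 - (1 - Real.cos x)) hi hk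
  have := halfMoment_comp_mul_left (fun x ↦ x ^ 2 / 2 - (1 - Real.cos x)) q hk
  rw [sub_mul, ← this, halfMoment, halfMoment, halfMoment, ← integral_const_mul,
    ← integral_sub hik (hi.const_mul _)]
  refine integral_congr_ae (Eventually.of_forall fun x ↦ ?_)
  simp only [cosDefect]; ring

theorem tendsto_one_sub_cos_div_sq :
    Tendsto (fun x : ℝ ↦ (1 - Real.cos x) / x ^ 2) (𝓝[>] 0) (𝓝 (1 / 2)) := by
  have h1 : Tendsto (fun x : ℝ ↦ x ^ 2 * (5 / 96)) (𝓝[>] 0) (𝓝 0) := by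
    have : Continuous fun x : ℝ ↦ x ^ 2 * (5 / 96) := by fun_prop
    simpa using (this.tendsto 0).mono_left nhdsWithin_le_nhds
  rw [tendsto_iff_norm_sub_tendsto_zero]
  refine squeeze_zero' (Eventually.of_forall fun x ↦ norm_nonneg _) ?_ h1
  filter_upwards [Ioc_mem_nhdsGT (zero_lt_one (α := ℝ))] with x hx
  have hx0 : 0 < x := hx.1
  have hb := Real.cos_bound (x := x) (by rw [abs_of_pos hx0]; exact hx.2)
  rw [abs_of_pos hx0] at hb
  have e : (1 - Real.cos x) / x ^ 2 - 1 / 2 = -(Real.cos x - (1 - x ^ 2 / 2)) / x ^ 2 := by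
    field_simp; ring
  rw [e, norm_div, norm_neg, Real.norm_eq_abs, Real.norm_eq_abs, abs_of_pos (by positivity : 0 < x ^ 2),
    div_le_iff₀ (by positivity)]
  linarith [hb]

theorem tendsto_one_sub_cos_div_sq_atTop :
    Tendsto (fun x : ℝ ↦ (1 - Real.cos x) / x ^ 2) atTop (𝓝 0) := by
  have h1 : Tendsto (fun x : ℝ ↦ 2 / x ^ 2) atTop (𝓝 0) :=
    tendsto_const_nhds.div_atTop (tendsto_pow_atTop (by norm_num))
  refine squeeze_zero (fun x ↦ div_nonneg (by linarith [Real.cos_le_one x]) (sq_nonneg _))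
    (fun x ↦ ?_) h1
  gcongr
  linarith [Real.neg_one_le_cos x]

/-- At `q = 2` neither splitting converges. The integrand is a Frullani difference of `(1 - cos x) /
x²`, which runs from `1/2` at the origin to `0` at infinity. -/
theorem halfMoment_cosDefect_two {k : ℝ} (hk : 0 < k)
    (hint : IntegrableOn (fun x ↦ x ^ (-(2 : ℝ) - 1) * cosDefect k x) (Set.Ioi 0)) :
    halfMoment (cosDefect k) 2 = k ^ 2 * Real.log k / 2 := by
  have e : Set.EqOn (fun x : ℝ ↦ x ^ (-(2 : ℝ) - 1) * cosDefect k x) (fun x ↦ k ^ 2 *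
      (x⁻¹ • ((1 - Real.cos (1 * x)) / (1 * x) ^ 2 - (1 - Real.cos (k * x)) / (k * x) ^ 2)))
      (Set.Ioi 0) := fun x hx ↦ by
    have hx' : 0 < x := hx
    have : x ^ (-(2 : ℝ) - 1) = (x ^ 3)⁻¹ := by
      rw [show (-(2 : ℝ) - 1) = -((3 : ℕ) : ℝ) by norm_num, Real.rpow_neg hx'.le, Real.rpow_natCast]
    simp only [cosDefect, this, smul_eq_mul, one_mul]
    field_simp
  have hloc : LocallyIntegrableOn (fun x : ℝ ↦ (1 - Real.cos x) / x ^ 2) (Set.Ioi 0) := by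
    refine ContinuousOn.locallyIntegrableOn ?_ measurableSet_Ioi
    refine ContinuousOn.div (by fun_prop) (by fun_prop) fun x hx ↦ ?_
    have hx' : 0 < x := hx
    positivity
  have hint' := hint.congr_fun e measurableSet_Ioi
  have hk2 : k ^ 2 ≠ 0 := by positivity
  have hint2 : IntegrableOn (fun x : ℝ ↦ x⁻¹ • ((1 - Real.cos (1 * x)) / (1 * x) ^ 2 -
      (1 - Real.cos (k * x)) / (k * x) ^ 2)) (Set.Ioi 0) := by
    refine IntegrableOn.congr_fun (hint'.const_mul (k ^ 2)⁻¹) (fun x _ ↦ ?_) measurableSet_Ioi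
    rw [inv_mul_cancel_left₀ hk2]
  have := Frullani.integral_Ioi_eq hloc one_pos hk tendsto_one_sub_cos_div_sq
    tendsto_one_sub_cos_div_sq_atTop hint2
  rw [halfMoment, setIntegral_congr_fun measurableSet_Ioi e, integral_const_mul, this]
  simp only [div_one, sub_zero, smul_eq_mul]
  ring

/-- The weight `sin⁴(x/2)`. -/
noncomputable def sinWeight (x : ℝ) : ℝ := Real.sin (x / 2) ^ 4

theorem continuous_sinWeight : Continuous sinWeight := by unfold sinWeight; fun_prop

theorem sinWeight_nonneg (x : ℝ) : 0 ≤ sinWeight x := by unfold sinWeight; positivity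

theorem sinWeight_le_one (x : ℝ) : sinWeight x ≤ 1 := by
  have h := Real.sin_sq_le_one (x / 2)
  have h0 := sq_nonneg (Real.sin (x / 2))
  unfold sinWeight
  nlinarith

theorem sinWeight_le_pow (x : ℝ) : sinWeight x ≤ x ^ 4 := by
  have h : Real.sin (x / 2) ^ 2 ≤ (x / 2) ^ 2 := Real.sin_sq_le_sq
  have h0 := sq_nonneg (Real.sin (x / 2))
  unfold sinWeight
  nlinarith [sq_nonneg x, pow_le_pow_left₀ h0 h 2, sq_nonneg (x ^ 2)]

theorem cosDefect_two (x : ℝ) : cosDefect 2 x = 8 * sinWeight x := by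
  have h1 : Real.cos (2 * x) = 2 * Real.cos x ^ 2 - 1 := Real.cos_two_mul x
  have h2 : Real.sin (x / 2) ^ 2 = (1 - Real.cos x) / 2 := by
    have := Real.sin_sq_eq_half_sub (x / 2)
    rw [this]; ring_nf
  have h3 : sinWeight x = ((1 - Real.cos x) / 2) ^ 2 := by rw [← h2]; unfold sinWeight; ring
  rw [cosDefect, h1, h3]; ring

/-- Together with `cosDefect_two` this expresses the variance and covariance weights through
defects, whose moments are governed by scaling. -/
theorem cosDefect_three (x : ℝ) :
    cosDefect 3 x = 16 * (Real.cos x * sinWeight x) + 32 * sinWeight x := by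
  have h1 : Real.cos (3 * x) = 4 * Real.cos x ^ 3 - 3 * Real.cos x := Real.cos_three_mul x
  have h2 : Real.sin (x / 2) ^ 2 = (1 - Real.cos x) / 2 := by
    have := Real.sin_sq_eq_half_sub (x / 2)
    rw [this]; ring_nf
  have h3 : sinWeight x = ((1 - Real.cos x) / 2) ^ 2 := by rw [← h2]; unfold sinWeight; ring
  rw [cosDefect, h1, h3]; ring

theorem integrableOn_rpow_mul_of_le_sinWeight {w : ℝ → ℝ} (hw : Continuous w)
    (hb : ∀ x, |w x| ≤ sinWeight x) {q : ℝ} (h0 : 0 < q) (h4 : q < 4) :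
    IntegrableOn (fun x ↦ x ^ (-q - 1) * w x) (Set.Ioi 0) := by
  refine integrableOn_Ioi_rpow_mul (a := 0) (b := 4) (C := 1) (C' := 1) hw h0 h4 ?_ ?_
  · intro x _ _
    have e : (x : ℝ) ^ (4 : ℝ) = x ^ 4 := by exact_mod_cast Real.rpow_natCast x 4
    rw [e, one_mul]
    exact (hb x).trans (sinWeight_le_pow x)
  · intro x _
    rw [Real.rpow_zero, one_mul]
    exact (hb x).trans (sinWeight_le_one x)

theorem abs_sinWeight_le (x : ℝ) : |sinWeight x| ≤ sinWeight x :=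
  (abs_of_nonneg (sinWeight_nonneg x)).le

theorem abs_cos_mul_sinWeight_le (x : ℝ) : |Real.cos x * sinWeight x| ≤ sinWeight x := by
  rw [abs_mul, abs_of_nonneg (sinWeight_nonneg x)]
  exact mul_le_of_le_one_left (sinWeight_nonneg x) (Real.abs_cos_le_one x)

theorem continuous_cos_mul_sinWeight : Continuous fun x ↦ Real.cos x * sinWeight x :=
  Real.continuous_cos.mul continuous_sinWeight

/-- `∫₀^∞ x^{-q-1} sin⁴(x/2) dx`. -/
noncomputable def varMoment (q : ℝ) : ℝ := halfMoment sinWeight q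

/-- `∫₀^∞ x^{-q-1} cos x sin⁴(x/2) dx`. -/
noncomputable def covMoment (q : ℝ) : ℝ := halfMoment (fun x ↦ Real.cos x * sinWeight x) q

theorem halfMoment_pos {g : ℝ → ℝ} {q : ℝ}
    (hi : IntegrableOn (fun x ↦ x ^ (-q - 1) * g x) (Set.Ioi 0)) (h0 : ∀ x, 0 ≤ g x)
    (h1 : ∀ x ∈ Set.Ioo (0 : ℝ) 1, 0 < g x) : 0 < halfMoment g q := by
  rw [halfMoment, setIntegral_pos_iff_support_of_nonneg_ae _ hi]
  · refine lt_of_lt_of_le ?_ (measure_mono (?_ : Set.Ioo (0 : ℝ) 1 ⊆ _))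
    · simp
    · intro x hx
      exact ⟨(mul_pos (Real.rpow_pos_of_pos hx.1 _) (h1 x hx)).ne', hx.1⟩
  · refine (ae_restrict_iff' measurableSet_Ioi).2 (Eventually.of_forall fun x hx ↦ ?_)
    exact mul_nonneg (Real.rpow_nonneg (le_of_lt hx) _) (h0 x)

theorem sinWeight_pos {x : ℝ} (hx : x ∈ Set.Ioo (0 : ℝ) 1) : 0 < sinWeight x :=
  pow_pos (Real.sin_pos_of_pos_of_lt_pi (by linarith [hx.1])
    (by linarith [hx.2, Real.pi_gt_three])) 4

/-- The sum and difference of the two moments are moments of `(1 ± cos x) sin⁴(x/2)`, which is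
nonnegative and positive on `(0, 1)`. This keeps the limiting correlation inside `(-1, 1)`. -/
theorem abs_covMoment_lt {q : ℝ} (h0 : 0 < q) (h4 : q < 4) : |covMoment q| < varMoment q := by
  have hV := integrableOn_rpow_mul_of_le_sinWeight continuous_sinWeight abs_sinWeight_le h0 h4
  have hC := integrableOn_rpow_mul_of_le_sinWeight continuous_cos_mul_sinWeight
    abs_cos_mul_sinWeight_le h0 h4
  have key : ∀ c : ℝ, |c| = 1 → 0 < varMoment q + c * covMoment q := fun c hc ↦ by
    have e : varMoment q + c * covMoment q = halfMoment (fun x ↦ (1 + c * Real.cos x) * sinWeight x) q := by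
      rw [varMoment, covMoment, halfMoment, halfMoment, halfMoment, ← integral_const_mul,
        ← integral_add hV (hC.const_mul c)]
      refine integral_congr_ae (Eventually.of_forall fun x ↦ ?_)
      simp only; ring
    rw [e]
    refine halfMoment_pos ?_ (fun x ↦ ?_) fun x hx ↦ ?_
    · refine (hV.add (hC.const_mul c)).congr_fun (fun x _ ↦ ?_) measurableSet_Ioi
      simp only [Pi.add_apply]; ring
    · refine mul_nonneg ?_ (sinWeight_nonneg x)
      have : |c * Real.cos x| ≤ 1 := by rw [abs_mul, hc, one_mul]; exact Real.abs_cos_le_one x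
      linarith [neg_le_of_abs_le this]
    · refine mul_pos ?_ (sinWeight_pos hx)
      have h1 : 0 < Real.cos x := Real.cos_pos_of_mem_Ioo
        ⟨by linarith [hx.1, Real.pi_gt_three], by linarith [hx.2, Real.pi_gt_three]⟩
      have h2 : Real.cos x < 1 := by
        rw [← Real.cos_zero]
        exact Real.cos_lt_cos_of_nonneg_of_le_pi le_rfl (by linarith [hx.2, Real.pi_gt_three]) hx.1
      have : |c * Real.cos x| < 1 := by rw [abs_mul, hc, one_mul, abs_of_pos h1]; exact h2
      linarith [neg_lt_of_abs_lt this]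
  have k1 := key 1 (by simp)
  have k2 := key (-1) (by simp)
  rw [abs_lt]
  constructor <;> linarith

theorem varMoment_pos {q : ℝ} (h0 : 0 < q) (h4 : q < 4) : 0 < varMoment q :=
  (abs_nonneg _).trans_lt (abs_covMoment_lt h0 h4)

/-! ### Secant slopes, the function `ρ`, and strict monotonicity. -/

/-- Half the slope of the secant of `u ↦ u ^ (log 3 / log 2)` between `4` and `2 ^ q`. -/
noncomputable def secantRatio (q : ℝ) : ℝ :=
  if q = 2 then 9 * Real.log 3 / (8 * Real.log 2) else ((3 : ℝ) ^ q - 9) / (2 * ((2 : ℝ) ^ q - 4))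

theorem two_rpow_ne_four {q : ℝ} (hq : q ≠ 2) : (2 : ℝ) ^ q - 4 ≠ 0 := by
  intro h
  refine hq ?_
  have h2 : (2 : ℝ) ^ q = 2 ^ (2 : ℝ) := by rw [Real.rpow_two]; linarith
  exact (Real.strictMono_rpow_of_base_gt_one (by norm_num)).injective h2

/-- The defects for `k = 2` and `k = 3` have moments `8 V` and `16 (C + 2 V)`. For `q ≠ 2` both are
`k² - k^q` times the same constant, which cancels in the quotient and never has to be computed. -/
theorem covMoment_add_two_mul {q : ℝ} (h0 : 0 < q) (h4 : q < 4) :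
    covMoment q + 2 * varMoment q = secantRatio q * varMoment q := by
  have hV := integrableOn_rpow_mul_of_le_sinWeight continuous_sinWeight abs_sinWeight_le h0 h4
  have hC := integrableOn_rpow_mul_of_le_sinWeight continuous_cos_mul_sinWeight
    abs_cos_mul_sinWeight_le h0 h4
  have e2 : halfMoment (cosDefect 2) q = 8 * varMoment q := by
    rw [varMoment, halfMoment, halfMoment, ← integral_const_mul]
    refine integral_congr_ae (Eventually.of_forall fun x ↦ ?_)
    simp only [cosDefect_two]; ring
  have e3 : halfMoment (cosDefect 3) q = 16 * (covMoment q + 2 * varMoment q) := by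
    rw [varMoment, covMoment, halfMoment, halfMoment, halfMoment, ← integral_const_mul 2,
      ← integral_add hC (hV.const_mul 2), ← integral_const_mul]
    refine integral_congr_ae (Eventually.of_forall fun x ↦ ?_)
    simp only [cosDefect_three]; ring
  unfold secantRatio
  rcases lt_trichotomy q 2 with h | h | h
  · rw [if_neg h.ne]
    have hn := two_rpow_ne_four h.ne
    rw [halfMoment_cosDefect_of_lt h0 h two_pos] at e2
    rw [halfMoment_cosDefect_of_lt h0 h three_pos] at e3
    field_simp
    linear_combination (3 ^ q - 9) * e2 / 8 - (2 ^ q - 4) * e3 / 8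
  · subst h
    rw [if_pos rfl]
    have hl := Real.log_pos (one_lt_two (α := ℝ))
    rw [halfMoment_cosDefect_two two_pos] at e2
    · rw [halfMoment_cosDefect_two three_pos] at e3
      · field_simp
        linear_combination 9 * Real.log 3 * e2 / 8 * 8 /8 - Real.log 2 * e3 / 2
      · refine IntegrableOn.congr_fun ((hC.const_mul 16).add (hV.const_mul 32)) (fun x _ ↦ ?_) measurableSet_Ioi
        simp only [Pi.add_apply, cosDefect_three]; ring
    · refine IntegrableOn.congr_fun (hV.const_mul 8) (fun x _ ↦ ?_) measurableSet_Ioi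
      simp only [cosDefect_two]; ring
  · rw [if_neg h.ne']
    have hn := two_rpow_ne_four h.ne'
    rw [halfMoment_cosDefect_of_gt h h4 two_pos] at e2
    rw [halfMoment_cosDefect_of_gt h h4 three_pos] at e3
    field_simp
    linear_combination (3 ^ q - 9) * e2 / 8 - (2 ^ q - 4) * e3 / 8

/-- With `u = 2 ^ q` and `κ = log 3 / log 2 > 1` one has `3 ^ q = u ^ κ`. Slopes of secants of a
strictly convex function through the fixed point `u = 4` increase strictly in `u`; the value at `q =
2` is half the tangent slope there. -/
theorem strictMono_secantRatio : StrictMono secantRatio := by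
  set κ := Real.log 3 / Real.log 2 with hκ
  have hl2 := Real.log_pos (one_lt_two (α := ℝ))
  have hl : Real.log 2 < Real.log 3 := Real.log_lt_log two_pos (by norm_num)
  have hκ1 : 1 < κ := by rw [hκ, one_lt_div hl2]; exact hl
  have hconv := strictConvexOn_rpow hκ1
  have h23 : (2 : ℝ) ^ κ = 3 := by
    rw [Real.rpow_def_of_pos two_pos, hκ, mul_div_cancel₀ _ hl2.ne', Real.exp_log three_pos]
  have hpow : ∀ q : ℝ, ((2 : ℝ) ^ q) ^ κ = 3 ^ q := fun q ↦ by
    rw [← Real.rpow_mul two_pos.le, mul_comm, Real.rpow_mul two_pos.le, h23]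
  have h22 : (2 : ℝ) ^ (2 : ℝ) = 4 := by rw [Real.rpow_two]; norm_num
  have h32 : (3 : ℝ) ^ (2 : ℝ) = 9 := by rw [Real.rpow_two]; norm_num
  have h4κ : (4 : ℝ) ^ κ = 9 := by rw [← h22, hpow, h32]
  have hmono : StrictMono fun q : ℝ ↦ (2 : ℝ) ^ q := Real.strictMono_rpow_of_base_gt_one one_lt_two
  have hderiv : HasDerivAt (fun x : ℝ ↦ x ^ κ) (9 * Real.log 3 / (4 * Real.log 2)) 4 := by
    have := Real.hasDerivAt_rpow_const (x := 4) (p := κ) (Or.inl (by norm_num))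
    rw [Real.rpow_sub_one (by norm_num), h4κ] at this
    convert this using 1
    rw [hκ]; ring
  have hpos : ∀ q : ℝ, (2 : ℝ) ^ q ∈ Set.Ici (0 : ℝ) := fun q ↦ Real.rpow_nonneg two_pos.le q
  have h4m : (4 : ℝ) ∈ Set.Ici (0 : ℝ) := by simp
  have hs : ∀ q, q ≠ 2 → secantRatio q = (((2 : ℝ) ^ q) ^ κ - 4 ^ κ) / (2 ^ q - 4) / 2 := fun q hq ↦ by
    rw [secantRatio, if_neg hq, hpow, h4κ, div_div]; ring
  have hs2 : secantRatio 2 = 9 * Real.log 3 / (4 * Real.log 2) / 2 := by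
    rw [secantRatio, if_pos rfl, div_div]; ring
  have hne : ∀ q : ℝ, q ≠ 2 → (2 : ℝ) ^ q ≠ 4 := fun q hq h ↦ two_rpow_ne_four hq (by linarith)
  intro a b hab
  by_cases ha : a = 2
  · subst ha
    rw [hs2, hs b hab.ne']
    have h4b : (4 : ℝ) < 2 ^ b := by rw [← h22]; exact hmono hab
    have := hconv.lt_slope_of_hasDerivAt h4m (hpos b) h4b hderiv
    rw [slope_def_field] at this
    linarith
  · by_cases hb : b = 2
    · subst hb
      rw [hs2, hs a ha]
      have h4b : (2 : ℝ) ^ a < 4 := by rw [← h22]; exact hmono hab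
      have := hconv.slope_lt_of_hasDerivAt (hpos a) h4m h4b hderiv
      rw [slope_def_field, ← neg_div_neg_eq, neg_sub, neg_sub] at this
      linarith
    · rw [hs a ha, hs b hb]
      have := hconv.secant_strict_mono h4m (hpos a) (hpos b) (hne a ha) (hne b hb) (hmono hab)
      linarith

theorem secantRatio_zero : secantRatio 0 = 4 / 3 := by
  rw [secantRatio, if_neg (by norm_num)]; norm_num

theorem irRho_eq (d : ℝ) : irRho d = secantRatio (1 + 2 * d) - 2 := by
  unfold irRho secantRatio
  have e : (d = 1 / 2) = (1 + 2 * d = 2) := by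
    ext; constructor <;> intro h <;> linarith
  simp only [e]
  split_ifs with h
  · rfl
  · have hn := two_rpow_ne_four h
    have e4 : ∀ x : ℝ, (4 : ℝ) ^ x = 2 ^ (2 * x) := fun x ↦ by
      rw [Real.rpow_mul two_pos.le, Real.rpow_two]; norm_num
    have e9 : ∀ x : ℝ, (9 : ℝ) ^ x = 3 ^ (2 * x) := fun x ↦ by
      rw [Real.rpow_mul three_pos.le, Real.rpow_two]; norm_num
    have e1 : (4 : ℝ) ^ (d + 3 / 2) = 4 * 2 ^ (1 + 2 * d) := by
      rw [e4, show 2 * (d + 3 / 2) = (1 + 2 * d) + 2 by ring, Real.rpow_add two_pos, Real.rpow_two]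
      ring
    have e2 : (4 : ℝ) ^ (d + 1 / 2) = 2 ^ (1 + 2 * d) := by rw [e4]; congr 1; ring
    have e3 : (9 : ℝ) ^ (d + 1 / 2) = 3 ^ (1 + 2 * d) := by rw [e9]; congr 1; ring
    rw [e1, e2, e3]
    have hn' : 4 - (2 : ℝ) ^ (1 + 2 * d) ≠ 0 := by
      intro h'; exact hn (by linarith)
    field_simp
    ring

/-! ### Expansion of `f(x) / sin⁴(x/2)` at the origin. -/

/-- For `y > 1` Jordan's inequality bounds the fourth power by `16`, which suffices. For `y ≤ 1` the
Taylor bound of `sin y / y` is squared twice and then inverted. -/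
theorem abs_div_sin_pow_four_sub_le {y : ℝ} (h0 : 0 < y) (h1 : y < Real.pi / 2) :
    |(y / Real.sin y) ^ 4 - 1 - 2 / 3 * y ^ 2| ≤ 16 * y ^ 3 := by
  have hsin : 0 < Real.sin y := Real.sin_pos_of_pos_of_lt_pi h0 (by linarith [Real.pi_pos])
  have hj := Real.mul_le_sin h0.le h1.le
  set s := Real.sin y / y with hs
  have hs0 : 1 / 2 ≤ s := by
    rw [hs, le_div_iff₀ h0]
    refine (mul_le_mul_of_nonneg_right ?_ h0.le).trans hj
    rw [div_le_div_iff₀ two_pos Real.pi_pos]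
    linarith [Real.pi_le_four]
  have hs1 : s ≤ 1 := by rw [hs, div_le_one h0]; exact Real.sin_le h0.le
  have hv : y / Real.sin y = s⁻¹ := by rw [hs, inv_div]
  rw [hv]
  have hsi : s⁻¹ ≤ 2 := by rw [inv_le_comm₀ (by linarith) two_pos]; linarith
  have hsi0 : 0 ≤ s⁻¹ := by positivity
  have hv16 : s⁻¹ ^ 4 ≤ 16 := by
    calc s⁻¹ ^ 4 ≤ 2 ^ 4 := by gcongr
      _ = 16 := by norm_num
  rcases le_or_gt 1 y with hy | hy
  · have hy3 : 1 ≤ y ^ 3 := one_le_pow₀ hy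
    have hy2 : y ^ 2 ≤ 4 := by
      have : y < 2 := by linarith [Real.pi_le_four]
      nlinarith
    have : 0 ≤ s⁻¹ ^ 4 := by positivity
    have := sq_nonneg y
    rw [abs_le]
    constructor <;> nlinarith
  · have hb := Real.sin_bound (x := y) (by rw [abs_of_pos h0]; exact hy.le)
    rw [abs_of_pos h0] at hb
    have hr : |s - (1 - y ^ 2 / 6)| ≤ y ^ 4 / 100 := by
      have e : s - (1 - y ^ 2 / 6) = (Real.sin y - (y - y ^ 3 / 6)) / y := by
        rw [hs]; field_simp
      rw [e, abs_div, abs_of_pos h0, div_le_iff₀ h0]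
      calc _ ≤ _ := hb
        _ = _ := by ring
    have hy2 : y ^ 2 ≤ 1 := by nlinarith
    have hy4 : 0 ≤ y ^ 4 := by positivity
    have hy22 : 0 ≤ y ^ 2 := by positivity
    have step1 : |s ^ 2 - (1 - y ^ 2 / 3)| ≤ y ^ 4 / 20 := by
      have e : s ^ 2 - (1 - y ^ 2 / 3) =
          (s - (1 - y ^ 2 / 6)) * (s + (1 - y ^ 2 / 6)) + y ^ 4 / 36 := by ring
      have b : |s + (1 - y ^ 2 / 6)| ≤ 2 := by rw [abs_le]; constructor <;> linarith
      rw [e]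
      refine (abs_add_le _ _).trans ?_
      rw [abs_mul, abs_of_nonneg (by positivity : 0 ≤ y ^ 4 / 36)]
      have := mul_le_mul hr b (abs_nonneg _) (by positivity)
      linarith
    have step2 : |s ^ 4 - (1 - 2 / 3 * y ^ 2)| ≤ y ^ 4 / 4 := by
      have e : s ^ 4 - (1 - 2 / 3 * y ^ 2) =
          (s ^ 2 - (1 - y ^ 2 / 3)) * (s ^ 2 + (1 - y ^ 2 / 3)) + y ^ 4 / 9 := by ring
      have b : |s ^ 2 + (1 - y ^ 2 / 3)| ≤ 2 := by
        rw [abs_le]; constructor <;> nlinarith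
      rw [e]
      refine (abs_add_le _ _).trans ?_
      rw [abs_mul, abs_of_nonneg (by positivity : 0 ≤ y ^ 4 / 9)]
      have := mul_le_mul step1 b (abs_nonneg _) (by positivity)
      linarith
    have step3 : |1 - s ^ 4 * (1 + 2 / 3 * y ^ 2)| ≤ y ^ 3 := by
      have e : 1 - s ^ 4 * (1 + 2 / 3 * y ^ 2) =
          -((s ^ 4 - (1 - 2 / 3 * y ^ 2)) * (1 + 2 / 3 * y ^ 2)) + 4 / 9 * y ^ 4 := by ring
      have b : |1 + 2 / 3 * y ^ 2| ≤ 5 / 3 := by rw [abs_le]; constructor <;> linarith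
      rw [e]
      refine (abs_add_le _ _).trans ?_
      rw [abs_neg, abs_mul, abs_of_nonneg (by positivity : 0 ≤ 4 / 9 * y ^ 4)]
      have := mul_le_mul step2 b (abs_nonneg _) (by positivity)
      have h43 : y ^ 4 ≤ y ^ 3 := pow_le_pow_of_le_one h0.le hy.le (by norm_num)
      linarith
    have e : s⁻¹ ^ 4 - 1 - 2 / 3 * y ^ 2 = s⁻¹ ^ 4 * (1 - s ^ 4 * (1 + 2 / 3 * y ^ 2)) := by
      have : s ≠ 0 := by linarith
      field_simp
      ring
    rw [e, abs_mul, abs_of_nonneg (by positivity)]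
    exact mul_le_mul hv16 step3 (abs_nonneg _) (by norm_num)

/-- Expansion of `sin(x/2)⁻⁴ = 16 x⁻⁴ (1 + x²/6 + O(x³))`. -/
theorem abs_pow_four_div_sinWeight_sub_le {x : ℝ} (h0 : 0 < x) (h1 : x < Real.pi) :
    |x ^ 4 / (16 * sinWeight x) - 1 - x ^ 2 / 6| ≤ 2 * x ^ 3 := by
  have h := abs_div_sin_pow_four_sub_le (y := x / 2) (by linarith) (by linarith)
  have e : x ^ 4 / (16 * sinWeight x) - 1 - x ^ 2 / 6 =
      (x / 2 / Real.sin (x / 2)) ^ 4 - 1 - 2 / 3 * (x / 2) ^ 2 := by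
    unfold sinWeight
    rw [div_pow, div_pow, div_div]
    norm_num
    ring
  rw [e]
  calc _ ≤ _ := h
    _ = _ := by ring

theorem rpow_le_pi_rpow_mul {x e e' : ℝ} (h0 : 0 < x) (h1 : x < Real.pi) (he : e' ≤ e) :
    x ^ e ≤ Real.pi ^ (e - e') * x ^ e' := by
  have : x ^ e = x ^ (e - e') * x ^ e' := by rw [← Real.rpow_add h0]; congr 1; ring
  rw [this]
  have := Real.rpow_le_rpow h0.le h1.le (sub_nonneg.2 he)
  gcongr

theorem sinWeight_pos_of_lt_pi {x : ℝ} (h0 : 0 < x) (h1 : x < Real.pi) : 0 < sinWeight x :=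
  pow_pos (Real.sin_pos_of_pos_of_lt_pi (by linarith) (by linarith [Real.pi_pos])) 4

/-- The product of the two expansions. The `x²/6` of the kernel joins the second-order term when `β
= 2` and the remainder when `β < 2`. Every small `δ` is allowed, so that later the remainder moment
can be kept of positive order. -/
theorem SpectralExpansion.exists_abs_div_sinWeight_le {f : ℝ → ℝ} {a β c₀ c₁ : ℝ} (hc₀ : 0 < c₀)
    (hβ2 : β ≤ 2) (h : SpectralExpansion f a β c₀ c₁) :
    ∃ δ₀ > 0, ∀ δ, 0 < δ → δ ≤ δ₀ → ∃ C, 0 ≤ C ∧ ∀ x, 0 < x → x < Real.pi → ∀ y, (y = x ∨ y = -x) →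
      |f y / sinWeight x - 16 * c₀ * (x ^ (a - 4) + secondOrderCoeff β c₀ c₁ * x ^ (a - 4 + β))| ≤
        C * x ^ (a - 4 + β + δ) := by
  obtain ⟨ε, hε, _, _, C, hC⟩ := h
  -- The gap between `β` and the first power left over from the kernel: `x³` if `β = 2`, otherwise
  -- `x²`.
  set τ : ℝ := if β = 2 then 1 else 2 - β with hτ
  have hτ0 : 0 < τ := by
    rw [hτ]; split_ifs with h
    · norm_num
    · have := lt_of_le_of_ne hβ2 h
      linarith
  refine ⟨min ε (min 1 τ), by positivity, fun δ hδ hδ' ↦ ?_⟩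
  have hδε : δ ≤ ε := hδ'.trans (min_le_left _ _)
  have hδ1 : δ ≤ 1 := hδ'.trans ((min_le_right _ _).trans (min_le_left _ _))
  have hδτ : δ ≤ τ := hδ'.trans ((min_le_right _ _).trans (min_le_right _ _))
  have hpi := Real.pi_pos
  set L : ℝ := 1 + Real.pi ^ 2 / 6 + 2 * Real.pi ^ 3 with hL
  have hL0 : 0 ≤ L := by positivity
  have hv3 : ∀ x, 0 < x → x < Real.pi → |x ^ 4 / (16 * sinWeight x) - 1 - x ^ 2 / 6| ≤ 2 * x ^ 3 :=
    fun x h0 h1 ↦ abs_pow_four_div_sinWeight_sub_le h0 h1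
  have hv2 : ∀ x, 0 < x → x < Real.pi → |x ^ 4 / (16 * sinWeight x) - 1| ≤ L * x ^ 2 := by
    intro x h0 h1
    have e : x ^ 4 / (16 * sinWeight x) - 1 =
        (x ^ 4 / (16 * sinWeight x) - 1 - x ^ 2 / 6) + x ^ 2 / 6 := by ring
    rw [e]
    refine (abs_add_le _ _).trans ?_
    rw [abs_of_nonneg (by positivity : 0 ≤ x ^ 2 / 6)]
    have h3 := hv3 x h0 h1
    have h4 : x ^ 3 ≤ Real.pi * x ^ 2 := by
      rw [pow_succ' x 2]; gcongr
    have h5 : Real.pi ≤ Real.pi ^ 3 := by nlinarith [Real.pi_gt_three]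
    have h6 : 0 ≤ x ^ 2 := by positivity
    rw [hL]
    nlinarith [mul_le_mul_of_nonneg_right h5 h6, mul_nonneg (sq_nonneg Real.pi) h6]
  have hv1 : ∀ x, 0 < x → x < Real.pi → |x ^ 4 / (16 * sinWeight x)| ≤ L := by
    intro x h0 h1
    have h3 := abs_le.1 (hv3 x h0 h1)
    have h4 : x ^ 3 ≤ Real.pi ^ 3 := by gcongr
    have h5 : x ^ 2 ≤ Real.pi ^ 2 := by gcongr
    have := sinWeight_nonneg x
    rw [abs_of_nonneg (by positivity), hL]
    linarith [h3.2]
  have hvc : ∃ M, 0 ≤ M ∧ ∀ x, 0 < x → x < Real.pi →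
      |x ^ 4 / (16 * sinWeight x) - 1 - (if β = 2 then 1 / 6 else 0) * x ^ β| ≤
        M * x ^ (β + δ) := by
    by_cases hb : β = 2
    · refine ⟨2 * Real.pi ^ (3 - (β + δ)), by positivity, fun x h0 h1 ↦ ?_⟩
      rw [if_pos hb]
      have h3 := hv3 x h0 h1
      have h4 := rpow_le_pi_rpow_mul (e := 3) (e' := β + δ) h0 h1 (by rw [hb]; linarith)
      have e3 : x ^ (3 : ℝ) = x ^ 3 := by exact_mod_cast Real.rpow_natCast x 3
      have eb : x ^ β = x ^ 2 := by rw [hb, Real.rpow_two]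
      rw [e3] at h4
      rw [eb, show (1 / 6 : ℝ) * x ^ 2 = x ^ 2 / 6 by ring]
      linarith
    · refine ⟨L * Real.pi ^ (2 - (β + δ)), by positivity, fun x h0 h1 ↦ ?_⟩
      rw [if_neg hb, zero_mul, sub_zero]
      rw [hτ, if_neg hb] at hδτ
      have h3 := hv2 x h0 h1
      have h4 := rpow_le_pi_rpow_mul (e := 2) (e' := β + δ) h0 h1 (by linarith)
      rw [Real.rpow_two] at h4
      have := mul_le_mul_of_nonneg_left h4 hL0
      linarith
  obtain ⟨M, hM, hvM⟩ := hvc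
  refine ⟨16 * (L * (|C| * Real.pi ^ (ε - δ)) + L * |c₁| * Real.pi ^ (2 - δ) + c₀ * M),
    by positivity, fun x h0 h1 y hy ↦ ?_⟩
  have hW := sinWeight_pos_of_lt_pi h0 h1
  set v := x ^ 4 / (16 * sinWeight x) with hv
  have hy' : y ∈ Set.Ioo (-Real.pi) 0 ∪ Set.Ioo 0 Real.pi := by
    rcases hy with rfl | rfl
    · exact Or.inr ⟨h0, h1⟩
    · exact Or.inl ⟨by linarith, by linarith⟩
  have hay : |y| = x := by
    rcases hy with rfl | rfl
    · exact abs_of_pos h0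
    · rw [abs_neg, abs_of_pos h0]
  have hf := (hC y hy').1
  rw [hay] at hf
  set g := f y - (c₀ * x ^ a + c₁ * x ^ (a + β)) with hg
  have hx4 : x ^ (a - 4) * x ^ 4 = x ^ a := by
    rw [← Real.rpow_natCast x 4, ← Real.rpow_add h0]; congr 1; push_cast; ring
  have hxβ : ∀ b, x ^ (b + β) = x ^ b * x ^ β := fun b ↦ Real.rpow_add h0 _ _
  have hinv : x ^ a * x ^ (-a) = 1 := by rw [← Real.rpow_add h0]; simp
  -- Three errors: the remainder of `f`, the kernel correction to the `c₁` term, and the kernel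
  -- correction to the `c₀` term beyond the part kept in the coefficient.
  have key : f y / sinWeight x -
      16 * c₀ * (x ^ (a - 4) + secondOrderCoeff β c₀ c₁ * x ^ (a - 4 + β)) =
      16 * x ^ (a - 4) * (v * (x ^ (-a) * g) + (v - 1) * (c₁ * x ^ β) +
        c₀ * (v - 1 - (if β = 2 then 1 / 6 else 0) * x ^ β)) := by
    have e1 : f y / sinWeight x = 16 * x ^ (a - 4) * (v * (x ^ (-a) * f y)) := by
      rw [hv]
      have : 16 * x ^ (a - 4) * (x ^ 4 / (16 * sinWeight x) * (x ^ (-a) * f y)) =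
        ((x ^ (a - 4) * x ^ 4) * x ^ (-a)) * f y / sinWeight x := by field_simp
      rw [this, hx4, hinv, one_mul]
    have e2 : c₀ * secondOrderCoeff β c₀ c₁ = c₁ + c₀ * (if β = 2 then 1 / 6 else 0) := by
      rw [secondOrderCoeff]; field_simp
    have e3 : x ^ (-a) * g = x ^ (-a) * f y - c₀ - c₁ * x ^ β := by
      rw [hg, hxβ]
      linear_combination (-c₀ - c₁ * x ^ β) * hinv
    rw [e1, e3, hxβ]
    linear_combination (-16 * x ^ (a - 4) * x ^ β) * e2
  have hx0 : 0 < x ^ (a - 4) := Real.rpow_pos_of_pos h0 _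
  have b1 : |v * (x ^ (-a) * g)| ≤ L * (|C| * Real.pi ^ (ε - δ)) * x ^ (β + δ) := by
    rw [abs_mul, abs_mul, abs_of_pos (Real.rpow_pos_of_pos h0 _), mul_assoc]
    refine mul_le_mul (hv1 x h0 h1) ?_ (by positivity) hL0
    have h2 : |g| ≤ |C| * x ^ (a + β + ε) :=
      hf.trans (by gcongr; exact le_abs_self C)
    have h3 := rpow_le_pi_rpow_mul (e := β + ε) (e' := β + δ) h0 h1 (by linarith)
    have e4 : x ^ (-a) * x ^ (a + β + ε) = x ^ (β + ε) := by
      rw [← Real.rpow_add h0]; congr 1; ring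
    calc x ^ (-a) * |g| ≤ x ^ (-a) * (|C| * x ^ (a + β + ε)) := by gcongr
      _ = |C| * x ^ (β + ε) := by rw [← e4]; ring
      _ ≤ |C| * (Real.pi ^ (β + ε - (β + δ)) * x ^ (β + δ)) := by gcongr
      _ = |C| * Real.pi ^ (ε - δ) * x ^ (β + δ) := by
        rw [show β + ε - (β + δ) = ε - δ by ring]; ring
  have b2 : |(v - 1) * (c₁ * x ^ β)| ≤ L * |c₁| * Real.pi ^ (2 - δ) * x ^ (β + δ) := by
    rw [abs_mul, abs_mul, abs_of_pos (Real.rpow_pos_of_pos h0 β)]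
    have h3 := rpow_le_pi_rpow_mul (e := β + 2) (e' := β + δ) h0 h1 (by linarith)
    rw [Real.rpow_add h0, Real.rpow_two] at h3
    calc |v - 1| * (|c₁| * x ^ β) ≤ (L * x ^ 2) * (|c₁| * x ^ β) := by
          gcongr; exact hv2 x h0 h1
      _ = L * |c₁| * (x ^ β * x ^ 2) := by ring
      _ ≤ L * |c₁| * (Real.pi ^ (β + 2 - (β + δ)) * x ^ (β + δ)) := by gcongr
      _ = _ := by rw [show β + 2 - (β + δ) = 2 - δ by ring]; ring
  have b3 : |c₀ * (v - 1 - (if β = 2 then 1 / 6 else 0) * x ^ β)| ≤ c₀ * M * x ^ (β + δ) := by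
    rw [abs_mul, abs_of_pos hc₀, mul_assoc]
    exact mul_le_mul_of_nonneg_left (hvM x h0 h1) hc₀.le
  rw [key, abs_mul, abs_of_pos (by positivity : 0 < 16 * x ^ (a - 4))]
  have e5 : x ^ (a - 4 + β + δ) = x ^ (a - 4) * x ^ (β + δ) := by
    rw [← Real.rpow_add h0]; congr 1; ring
  rw [e5]
  calc _ ≤ 16 * x ^ (a - 4) * (L * (|C| * Real.pi ^ (ε - δ)) * x ^ (β + δ) +
        L * |c₁| * Real.pi ^ (2 - δ) * x ^ (β + δ) + c₀ * M * x ^ (β + δ)) := by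
        gcongr
        exact (abs_add_three _ _ _).trans (by linarith)
    _ = _ := by ring

/-! ### Truncated moments and their growth. -/

/-- The truncated moment `∫₀^R x^{-q-1} g(x) dx`. -/
noncomputable def truncMoment (g : ℝ → ℝ) (q R : ℝ) : ℝ := ∫ x in (0 : ℝ)..R, x ^ (-q - 1) * g x

theorem intervalIntegrable_rpow_mul {w : ℝ → ℝ} (hw : Continuous w)
    (hb : ∀ x, |w x| ≤ sinWeight x) {q : ℝ} (h4 : q < 4) {R : ℝ} (hR : 0 ≤ R) :
    IntervalIntegrable (fun x ↦ x ^ (-q - 1) * w x) volume 0 R := by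
  have h := intervalIntegral.intervalIntegrable_rpow' (a := 0) (b := R) (r := 3 - q) (by linarith)
  refine h.mono_fun (Measurable.aestronglyMeasurable (by have := hw.measurable; fun_prop)) ?_
  refine (ae_restrict_iff' measurableSet_uIoc).2 (Eventually.of_forall fun x hx ↦ ?_)
  rw [Set.uIoc_of_le hR] at hx
  have hx0 : 0 < x := hx.1
  beta_reduce
  rw [norm_mul, Real.norm_eq_abs, Real.norm_eq_abs, Real.norm_eq_abs,
    abs_of_pos (Real.rpow_pos_of_pos hx0 _), abs_of_pos (Real.rpow_pos_of_pos hx0 _)]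
  have e : x ^ (3 - q) = x ^ (-q - 1) * x ^ 4 := by
    rw [← Real.rpow_natCast x 4, ← Real.rpow_add hx0]; congr 1; push_cast; ring
  rw [e]
  have := (hb x).trans (sinWeight_le_pow x)
  gcongr

theorem intervalIntegrable_rpow_mul_comp {w : ℝ → ℝ} (hw : Continuous w)
    (hb : ∀ x, |w x| ≤ sinWeight x) {q : ℝ} (h4 : q < 4) {R k : ℝ} (hR : 0 ≤ R) (hk : 0 < k) :
    IntervalIntegrable (fun x ↦ x ^ (-q - 1) * w (k * x)) volume 0 R := by
  have h := (intervalIntegrable_rpow_mul hw hb h4 (mul_nonneg hk.le hR)).comp_mul_left (c := k)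
  rw [zero_div, mul_div_cancel_left₀ _ hk.ne'] at h
  refine (h.const_mul (k ^ (q + 1))).congr fun x hx ↦ ?_
  rw [Set.uIoc_of_le hR] at hx
  rw [Real.mul_rpow hk.le hx.1.le]
  have : k ^ (q + 1) * k ^ (-q - 1) = 1 := by
    rw [← Real.rpow_add hk]; simp
  linear_combination (x ^ (-q - 1) * w (k * x)) * this

theorem integral_rpow_mul_comp (w : ℝ → ℝ) (q : ℝ) {R k : ℝ} (hR : 0 ≤ R) (hk : 0 < k) :
    ∫ x in (0 : ℝ)..R, x ^ (-q - 1) * w (k * x) = k ^ q * truncMoment w q (k * R) := by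
  have h := intervalIntegral.integral_comp_mul_left (a := 0) (b := R)
    (fun x ↦ x ^ (-q - 1) * w x) hk.ne'
  rw [mul_zero, smul_eq_mul] at h
  rw [truncMoment, ← mul_inv_cancel_left₀ hk.ne' (∫ x in (0 : ℝ)..(k * R), x ^ (-q - 1) * w x), ← h,
    ← mul_assoc, ← intervalIntegral.integral_const_mul]
  refine intervalIntegral.integral_congr_ae (Eventually.of_forall fun x hx ↦ ?_)
  rw [Set.uIoc_of_le hR] at hx
  rw [Real.mul_rpow hk.le hx.1.le]
  have : k ^ q * k * k ^ (-q - 1) = 1 := by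
    rw [← Real.rpow_add_one hk.ne', ← Real.rpow_add hk]; simp
  linear_combination -(x ^ (-q - 1) * w (k * x)) * this

theorem abs_halfMoment_sub_truncMoment_le {w : ℝ → ℝ} (hw : Continuous w)
    (hb : ∀ x, |w x| ≤ sinWeight x) {q : ℝ} (h0 : 0 < q) (h4 : q < 4) {R : ℝ} (hR : 0 < R) :
    |truncMoment w q R - halfMoment w q| ≤ R ^ (-q) / q := by
  have hi := integrableOn_rpow_mul_of_le_sinWeight hw hb h0 h4
  have e := intervalIntegral.integral_interval_add_Ioi hi
    (hi.mono_set (Set.Ioi_subset_Ioi hR.le))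
  have e2 : truncMoment w q R - halfMoment w q =
      -∫ x in Set.Ioi R, x ^ (-q - 1) * w x := by
    rw [truncMoment, halfMoment, ← e]; ring
  rw [e2, abs_neg, ← Real.norm_eq_abs]
  have hI := integral_Ioi_rpow_of_lt (a := -q - 1) (c := R) (by linarith) hR
  have e3 : -R ^ (-q - 1 + 1) / (-q - 1 + 1) = R ^ (-q) / q := by
    rw [sub_add_cancel, neg_div_neg_eq]
  rw [← e3, ← hI]
  refine norm_integral_le_of_norm_le (integrableOn_Ioi_rpow_of_lt (by linarith) hR) ?_
  refine (ae_restrict_iff' measurableSet_Ioi).2 (Eventually.of_forall fun x hx ↦ ?_)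
  have hx0 : 0 < x := hR.trans hx
  rw [norm_mul, Real.norm_eq_abs, Real.norm_eq_abs, abs_of_pos (Real.rpow_pos_of_pos hx0 _)]
  exact mul_le_of_le_one_right (Real.rpow_nonneg hx0.le _) ((hb x).trans (sinWeight_le_one x))

theorem tendsto_truncMoment {w : ℝ → ℝ} (hw : Continuous w)
    (hb : ∀ x, |w x| ≤ sinWeight x) {q : ℝ} (h0 : 0 < q) (h4 : q < 4) :
    Tendsto (truncMoment w q) atTop (𝓝 (halfMoment w q)) :=
  intervalIntegral_tendsto_integral_Ioi 0 (integrableOn_rpow_mul_of_le_sinWeight hw hb h0 h4)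
    tendsto_id

/-- Moments of order zero grow logarithmically, at the rate of the mean value of the weight. -/
theorem exists_abs_truncMoment_zero_sub_le {w W : ℝ → ℝ} (hw : Continuous w)
    (hb : ∀ x, |w x| ≤ sinWeight x) {c B : ℝ} (hW : ∀ x, HasDerivAt W (w x - c) x)
    (hWB : ∀ x, |W x| ≤ B) :
    ∃ M, ∀ R, 1 ≤ R → |truncMoment w 0 R - c * Real.log R| ≤ M := by
  -- Integration by parts of `(w - c) / x` on `[1, R]` leaves two boundary terms and the integral of
  -- `W / x²`, each at most `B`.
  refine ⟨|truncMoment w 0 1| + 3 * B, fun R hR ↦ ?_⟩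
  have hR0 : 0 < R := by linarith
  have hB : 0 ≤ B := (abs_nonneg _).trans (hWB 0)
  have hWc : Continuous W := continuous_iff_continuousAt.2 fun x ↦ (hW x).continuousAt
  have hI1 := intervalIntegrable_rpow_mul hw hb (q := 0) (by norm_num) zero_le_one
  have hIR := intervalIntegrable_rpow_mul hw hb (q := 0) (by norm_num) hR0.le
  have hpos : ∀ x ∈ Set.uIcc 1 R, x ≠ 0 := fun x hx ↦ by
    rw [Set.uIcc_of_le hR] at hx
    have := hx.1
    linarith [hx.1] |> fun (h : 0 < x) ↦ h.ne'
  have hinv : ContinuousOn (fun x : ℝ ↦ x⁻¹) (Set.uIcc 1 R) := continuousOn_inv₀.mono hpos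
  have hd : ∀ x ∈ Set.uIcc 1 R, HasDerivAt (fun x ↦ W x * x⁻¹)
      ((w x - c) * x⁻¹ + W x * (-(x ^ 2)⁻¹)) x := fun x hx ↦ (hW x).mul (hasDerivAt_inv (hpos x hx))
  have hJ1 : IntervalIntegrable (fun x ↦ (w x - c) * x⁻¹) volume 1 R :=
    ((by fun_prop : Continuous fun x ↦ w x - c).continuousOn.mul hinv).intervalIntegrable
  have hsq : ContinuousOn (fun x : ℝ ↦ (x ^ 2)⁻¹) (Set.uIcc 1 R) :=
    ContinuousOn.inv₀ (by fun_prop) fun x hx ↦ pow_ne_zero 2 (hpos x hx)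
  have hJ2 : IntervalIntegrable (fun x ↦ W x * (-(x ^ 2)⁻¹)) volume 1 R :=
    (hWc.continuousOn.mul hsq.neg).intervalIntegrable
  have hftc := intervalIntegral.integral_eq_sub_of_hasDerivAt hd (hJ1.add hJ2)
  rw [intervalIntegral.integral_add hJ1 hJ2] at hftc
  have hlog : ∫ x in (1 : ℝ)..R, x⁻¹ = Real.log R := by
    rw [integral_inv_of_pos one_pos hR0, div_one]
  have e1 : truncMoment w 0 R - c * Real.log R =
      truncMoment w 0 1 + ∫ x in (1 : ℝ)..R, (w x - c) * x⁻¹ := by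
    have hadd := intervalIntegral.integral_add_adjacent_intervals hI1 (hI1.symm.trans hIR)
    rw [truncMoment, truncMoment, ← hadd, ← hlog, ← intervalIntegral.integral_const_mul,
      add_sub_assoc, ← intervalIntegral.integral_sub (hI1.symm.trans hIR)]
    · congr 1
      refine intervalIntegral.integral_congr fun x hx ↦ ?_
      simp only [neg_zero, zero_sub, Real.rpow_neg_one]
      ring
    · exact (hinv.intervalIntegrable).const_mul c
  have hbound : |∫ x in (1 : ℝ)..R, W x * (-(x ^ 2)⁻¹)| ≤ B := by
    have hsqI : ∫ x in (1 : ℝ)..R, B * (x ^ 2)⁻¹ = B * (1 - R⁻¹) := by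
      have hd2 : ∀ x ∈ Set.uIcc 1 R, HasDerivAt (fun x : ℝ ↦ -x⁻¹) ((x ^ 2)⁻¹) x := fun x hx ↦ by
        have := (hasDerivAt_inv (hpos x hx)).fun_neg
        rwa [neg_neg] at this
      rw [intervalIntegral.integral_const_mul,
        intervalIntegral.integral_eq_sub_of_hasDerivAt hd2 hsq.intervalIntegrable]
      norm_num
      left; ring
    rw [← Real.norm_eq_abs]
    refine (intervalIntegral.norm_integral_le_of_norm_le hR (Eventually.of_forall fun x hx ↦ ?_)
      (hsq.intervalIntegrable.const_mul B)).trans ?_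
    · rw [norm_mul, norm_neg, Real.norm_eq_abs, Real.norm_eq_abs,
        abs_of_nonneg (by positivity : 0 ≤ (x ^ 2)⁻¹)]
      gcongr
      exact hWB x
    · rw [hsqI]
      have : 0 ≤ R⁻¹ := by positivity
      nlinarith
  have e2 : ∫ x in (1 : ℝ)..R, (w x - c) * x⁻¹ =
      W R * R⁻¹ - W 1 - ∫ x in (1 : ℝ)..R, W x * (-(x ^ 2)⁻¹) := by
    rw [inv_one, mul_one] at hftc
    linarith
  have hWR : |W R * R⁻¹| ≤ B := by
    rw [abs_mul, abs_of_pos (inv_pos.2 hR0)]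
    calc |W R| * R⁻¹ ≤ B * 1 := by
          gcongr
          · exact hWB R
          · exact inv_le_one_of_one_le₀ hR
      _ = B := mul_one B
  rw [e1, e2]
  have a1 := abs_add_le (truncMoment w 0 1) (W R * R⁻¹ - W 1 - ∫ x in (1 : ℝ)..R, W x * (-(x ^ 2)⁻¹))
  have a2 := abs_sub (W R * R⁻¹ - W 1) (∫ x in (1 : ℝ)..R, W x * (-(x ^ 2)⁻¹))
  have a3 := abs_sub (W R * R⁻¹) (W 1)
  linarith [hWB 1]

/-! ### Second-order expansion of the spectral integrals. -/

section Expansion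

variable {f v : ℝ → ℝ}

theorem norm_expSum_mul_eq {m : ℕ} {x y : ℝ} (h0 : 0 < x) (h1 : x < Real.pi) (hy : y = x ∨ y = -x)
    (hve : ∀ x, v (-x) = v x) :
    v (m * y) * ‖expSum m y‖ ^ 4 * f y = v (m * x) * sinWeight (m * x) * (f y / sinWeight x) := by
  have hs : 0 < Real.sin (x / 2) :=
    Real.sin_pos_of_pos_of_lt_pi (by linarith) (by linarith [Real.pi_pos])
  rcases hy with rfl | rfl
  · rw [norm_expSum_pow_four m hs.ne']
    unfold sinWeight; ring
  · rw [norm_expSum_pow_four m (x := -x) (by rw [neg_div, Real.sin_neg]; exact (neg_ne_zero.2 hs.ne')),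
      mul_neg, hve, neg_div, neg_div, Real.sin_neg, Real.sin_neg, neg_pow (Real.sin (m * x / 2)),
      neg_pow (Real.sin (x / 2))]
    unfold sinWeight
    norm_num
    ring

/-- Splitting the spectral integral into its two leading terms and a remainder. -/
theorem abs_spectral_integral_sub_le {a β c₀ θ δ C : ℝ} (hf : IntegrableOn f
      (Set.Icc (-Real.pi) Real.pi)) (hv : Continuous v) (hv1 : ∀ x, |v x| ≤ 1)
    (hve : ∀ x, v (-x) = v x) (ha : -1 < a) (hβ : 0 < β) (hδ : 0 < δ)
    (hC : ∀ x, 0 < x → x < Real.pi → ∀ y, (y = x ∨ y = -x) →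
      |f y / sinWeight x - 16 * c₀ * (x ^ (a - 4) + θ * x ^ (a - 4 + β))| ≤
        C * x ^ (a - 4 + β + δ)) {m : ℕ} (hm : 0 < m) :
    |(∫ x in (-Real.pi)..Real.pi, v (m * x) * ‖expSum m x‖ ^ 4 * f x) -
      32 * c₀ * ((m : ℝ) ^ (3 - a) * truncMoment (fun x ↦ v x * sinWeight x) (3 - a) (m * Real.pi) +
        θ * ((m : ℝ) ^ (3 - a - β) *
          truncMoment (fun x ↦ v x * sinWeight x) (3 - a - β) (m * Real.pi)))| ≤
      2 * C * ((m : ℝ) ^ (3 - a - β - δ) * truncMoment sinWeight (3 - a - β - δ) (m * Real.pi)) := by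
  have hpi := Real.pi_pos
  have hm' : (0 : ℝ) < m := by exact_mod_cast hm
  set w : ℝ → ℝ := fun x ↦ v x * sinWeight x with hw
  have hwc : Continuous w := hv.mul continuous_sinWeight
  have hwb : ∀ x, |w x| ≤ sinWeight x := fun x ↦ by
    rw [hw]
    simp only
    rw [abs_mul, abs_of_nonneg (sinWeight_nonneg x)]
    exact mul_le_of_le_one_left (sinWeight_nonneg x) (hv1 x)
  set G : ℝ → ℝ := fun x ↦ v (m * x) * ‖expSum m x‖ ^ 4 * f x with hG
  have hGi : IntervalIntegrable G volume (-Real.pi) Real.pi := by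
    have hf' : IntervalIntegrable f volume (-Real.pi) Real.pi := by
      rwa [intervalIntegrable_iff_integrableOn_Icc_of_le (by linarith)]
    have := continuous_expSum m
    exact hf'.continuousOn_mul (by fun_prop)
  have hG1 : IntervalIntegrable G volume (-Real.pi) 0 := hGi.mono_set
    (by rw [Set.uIcc_of_le (by linarith), Set.uIcc_of_le (by linarith)]
        exact Set.Icc_subset_Icc_right hpi.le)
  have hG2 : IntervalIntegrable G volume 0 Real.pi := hGi.mono_set
    (by rw [Set.uIcc_of_le (by linarith), Set.uIcc_of_le (by linarith)]
        exact Set.Icc_subset_Icc_left (by linarith))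
  have hG3 : IntervalIntegrable (fun x ↦ G (-x)) volume 0 Real.pi := by
    have := (IntervalIntegrable.iff_comp_neg).1 hG1
    rw [neg_neg, neg_zero] at this
    exact this.symm
  have hsplit : ∫ x in (-Real.pi)..Real.pi, G x = ∫ x in (0 : ℝ)..Real.pi, (G x + G (-x)) := by
    rw [← intervalIntegral.integral_add_adjacent_intervals hG1 hG2,
      intervalIntegral.integral_add hG2 hG3, intervalIntegral.integral_comp_neg, neg_zero, add_comm]
  have hP1 := intervalIntegrable_rpow_mul_comp hwc hwb (q := 3 - a) (by linarith) hpi.le hm'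
  have hP2 := intervalIntegrable_rpow_mul_comp hwc hwb (q := 3 - a - β) (by linarith) hpi.le hm'
  have hP3 := intervalIntegrable_rpow_mul_comp continuous_sinWeight abs_sinWeight_le
    (q := 3 - a - β - δ) (by linarith) hpi.le hm'
  rw [hsplit, ← integral_rpow_mul_comp w _ hpi.le hm', ← integral_rpow_mul_comp w _ hpi.le hm',
    ← integral_rpow_mul_comp sinWeight _ hpi.le hm', ← intervalIntegral.integral_const_mul θ,
    ← intervalIntegral.integral_add hP1 (hP2.const_mul θ), ← intervalIntegral.integral_const_mul,
    ← intervalIntegral.integral_const_mul,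
    ← intervalIntegral.integral_sub (hG2.add hG3) ((hP1.add (hP2.const_mul θ)).const_mul _),
    ← Real.norm_eq_abs]
  refine intervalIntegral.norm_integral_le_of_norm_le hpi.le ?_ (hP3.const_mul _)
  -- The expansion of `f` is available on the open interval only.
  have hne : ∀ᵐ x : ℝ, x ≠ Real.pi := by simp [ae_iff]
  filter_upwards [hne] with x hxne hx
  have h0 : 0 < x := hx.1
  have h1 : x < Real.pi := lt_of_le_of_ne hx.2 hxne
  have eG : G x = w (m * x) * (f x / sinWeight x) := norm_expSum_mul_eq h0 h1 (Or.inl rfl) hve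
  have eG' : G (-x) = w (m * x) * (f (-x) / sinWeight x) :=
    norm_expSum_mul_eq h0 h1 (Or.inr rfl) hve
  have e1 : -(3 - a) - 1 = a - 4 := by ring
  have e2 : -(3 - a - β) - 1 = a - 4 + β := by ring
  have e3 : -(3 - a - β - δ) - 1 = a - 4 + β + δ := by ring
  rw [e1, e2, e3, eG, eG', Real.norm_eq_abs]
  have k1 := hC x h0 h1 x (Or.inl rfl)
  have k2 := hC x h0 h1 (-x) (Or.inr rfl)
  set A := 16 * c₀ * (x ^ (a - 4) + θ * x ^ (a - 4 + β)) with hA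
  -- The factor `32` is `16` from the kernel, doubled by folding `-x` onto `x`.
  have e : w (m * x) * (f x / sinWeight x) + w (m * x) * (f (-x) / sinWeight x) -
      32 * c₀ * (x ^ (a - 4) * w (m * x) + θ * (x ^ (a - 4 + β) * w (m * x))) =
      w (m * x) * ((f x / sinWeight x - A) + (f (-x) / sinWeight x - A)) := by
    rw [hA]; ring
  rw [e, abs_mul]
  calc |w (m * x)| * |(f x / sinWeight x - A) + (f (-x) / sinWeight x - A)| ≤
      sinWeight (m * x) * (C * x ^ (a - 4 + β + δ) + C * x ^ (a - 4 + β + δ)) :=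
        mul_le_mul (hwb _) ((abs_add_le _ _).trans (add_le_add k1 k2)) (abs_nonneg _)
          (sinWeight_nonneg _)
    _ = _ := by ring

end Expansion

/-- `∫_{-π}^{π} v(mx) |∑_{j<m} e^{ijx}|⁴ f(x) dx`. -/
noncomputable def spectralMoment (v f : ℝ → ℝ) (m : ℕ) : ℝ :=
  ∫ x in (-Real.pi)..Real.pi, v (m * x) * ‖expSum m x‖ ^ 4 * f x

/-- Shared by the power rate and the logarithmic rate. What depends on the rate is isolated in `h1`
(truncation of the main moment), `h2` (second-order term) and `h3` (remainder). -/
theorem tendsto_spectralMoment {f v : ℝ → ℝ} {a β c₀ θ δ C A B : ℝ} {η : ℕ → ℝ}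
    (hc₀ : 0 < c₀)
    (hf : IntegrableOn f (Set.Icc (-Real.pi) Real.pi)) (hv : Continuous v)
    (hv1 : ∀ x, |v x| ≤ 1) (hve : ∀ x, v (-x) = v x) (ha : -1 < a) (hβ : 0 < β) (hδ : 0 < δ)
    (hC : ∀ x, 0 < x → x < Real.pi → ∀ y, (y = x ∨ y = -x) →
      |f y / sinWeight x - 16 * c₀ * (x ^ (a - 4) + θ * x ^ (a - 4 + β))| ≤
        C * x ^ (a - 4 + β + δ))
    (hη : ∀ᶠ m in atTop, 0 < η m)
    (h1 : Tendsto (fun m : ℕ ↦ (truncMoment (fun x ↦ v x * sinWeight x) (3 - a) (m * Real.pi) - A) /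
      η m) atTop (𝓝 0))
    (h2 : Tendsto (fun m : ℕ ↦ (m : ℝ) ^ (-β) *
      truncMoment (fun x ↦ v x * sinWeight x) (3 - a - β) (m * Real.pi) / η m) atTop (𝓝 B))
    (h3 : Tendsto (fun m : ℕ ↦ (m : ℝ) ^ (-β - δ) *
      truncMoment sinWeight (3 - a - β - δ) (m * Real.pi) / η m) atTop (𝓝 0)) :
    Tendsto (fun m : ℕ ↦ (spectralMoment v f m / (32 * c₀ * (m : ℝ) ^ (3 - a)) - A) / η m) atTop
      (𝓝 (θ * B)) := by
  have h4 : Tendsto (fun m : ℕ ↦ (spectralMoment v f m / (32 * c₀ * (m : ℝ) ^ (3 - a)) -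
      (truncMoment (fun x ↦ v x * sinWeight x) (3 - a) (m * Real.pi) +
        θ * ((m : ℝ) ^ (-β) * truncMoment (fun x ↦ v x * sinWeight x) (3 - a - β) (m * Real.pi)))) /
        η m) atTop (𝓝 0) := by
    have h3' := h3.const_mul (C / (16 * c₀))
    rw [mul_zero] at h3'
    refine squeeze_zero_norm' ?_ h3'
    filter_upwards [hη, eventually_gt_atTop 0] with m hm hm0
    have hm' : (0 : ℝ) < m := by exact_mod_cast hm0
    have hb := abs_spectral_integral_sub_le (θ := θ) hf hv hv1 hve ha hβ hδ hC hm0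
    have hS : 0 < 32 * c₀ * (m : ℝ) ^ (3 - a) := by positivity
    have eβ : (m : ℝ) ^ (3 - a - β) = m ^ (3 - a) * m ^ (-β) := by
      rw [← Real.rpow_add hm']; congr 1
    have eδ : (m : ℝ) ^ (3 - a - β - δ) = m ^ (3 - a) * m ^ (-β - δ) := by
      rw [← Real.rpow_add hm']; congr 1; ring
    rw [eβ, eδ] at hb
    rw [norm_div, Real.norm_eq_abs, Real.norm_eq_abs, abs_of_pos hm, ← mul_div_assoc]
    gcongr
    rw [← mul_le_mul_iff_of_pos_left hS, ← abs_of_pos hS, ← abs_mul, abs_of_pos hS]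
    refine le_trans (le_of_eq ?_) (hb.trans (le_of_eq ?_))
    · congr 1
      rw [mul_sub, mul_div_cancel₀ _ hS.ne', spectralMoment]
      ring
    · field_simp
      ring
  have h5 := (h4.add h1).add (h2.const_mul θ)
  rw [add_zero, zero_add] at h5
  refine h5.congr fun m ↦ ?_
  ring

theorem tendsto_natCast_mul_pi : Tendsto (fun m : ℕ ↦ (m : ℝ) * Real.pi) atTop atTop :=
  tendsto_natCast_atTop_atTop.atTop_mul_const Real.pi_pos

theorem tendsto_natCast_rpow_neg {s : ℝ} (hs : 0 < s) :
    Tendsto (fun m : ℕ ↦ (m : ℝ) ^ (-s)) atTop (𝓝 0) :=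
  (tendsto_rpow_neg_atTop hs).comp tendsto_natCast_atTop_atTop

theorem tendsto_truncMoment_sub_div_rpow {w : ℝ → ℝ} (hw : Continuous w)
    (hb : ∀ x, |w x| ≤ sinWeight x) {q β : ℝ} (h0 : 0 < q) (h4 : q < 4) (hβ : β < q) :
    Tendsto (fun m : ℕ ↦ (truncMoment w q (m * Real.pi) - halfMoment w q) / (m : ℝ) ^ (-β)) atTop
      (𝓝 0) := by
  have h := (tendsto_natCast_rpow_neg (sub_pos.2 hβ)).mul_const (Real.pi ^ (-q) / q)
  rw [zero_mul] at h
  refine squeeze_zero_norm' ?_ h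
  filter_upwards [eventually_gt_atTop 0] with m hm0
  have hm' : (0 : ℝ) < m := by exact_mod_cast hm0
  have hpi := Real.pi_pos
  have hle := abs_halfMoment_sub_truncMoment_le hw hb h0 h4 (mul_pos hm' hpi)
  have hp : 0 < (m : ℝ) ^ (-β) := Real.rpow_pos_of_pos hm' _
  rw [norm_div, Real.norm_eq_abs, Real.norm_eq_abs, abs_of_pos hp, div_le_iff₀ hp]
  refine hle.trans (le_of_eq ?_)
  rw [Real.mul_rpow hm'.le hpi.le]
  have : (m : ℝ) ^ (-(q - β)) * (m : ℝ) ^ (-β) = (m : ℝ) ^ (-q) := by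
    rw [← Real.rpow_add hm']; congr 1; ring
  rw [← this]; ring

theorem SpectralExpansion.tendsto_spectralMoment {f v : ℝ → ℝ} {a β c₀ c₁ : ℝ} (hc₀ : 0 < c₀)
    (h : SpectralExpansion f a β c₀ c₁)
    (hf : IntegrableOn f (Set.Icc (-Real.pi) Real.pi)) (hv : Continuous v)
    (hv1 : ∀ x, |v x| ≤ 1) (hve : ∀ x, v (-x) = v x) (ha : -1 < a) (hβ : 0 < β) (hβ2 : β ≤ 2)
    (hβa : β < 3 - a) :
    Tendsto (fun m : ℕ ↦ (spectralMoment v f m / (32 * c₀ * (m : ℝ) ^ (3 - a)) -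
      halfMoment (fun x ↦ v x * sinWeight x) (3 - a)) / (m : ℝ) ^ (-β)) atTop
      (𝓝 (secondOrderCoeff β c₀ c₁ * halfMoment (fun x ↦ v x * sinWeight x) (3 - a - β))) := by
  obtain ⟨δ₀, hδ₀, hex⟩ := h.exists_abs_div_sinWeight_le hc₀ hβ2
  -- Keeps `3 - a - β - δ` positive, so that the remainder moment converges.
  have hδ : 0 < min δ₀ ((3 - a - β) / 2) := lt_min hδ₀ (by linarith)
  have hδ' : min δ₀ ((3 - a - β) / 2) ≤ (3 - a - β) / 2 := min_le_right _ _
  obtain ⟨C, -, hC⟩ := hex _ hδ (min_le_left _ _)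
  set δ := min δ₀ ((3 - a - β) / 2)
  have hwc : Continuous fun x ↦ v x * sinWeight x := hv.mul continuous_sinWeight
  have hwb : ∀ x, |v x * sinWeight x| ≤ sinWeight x := fun x ↦ by
    rw [abs_mul, abs_of_nonneg (sinWeight_nonneg x)]
    exact mul_le_of_le_one_left (sinWeight_nonneg x) (hv1 x)
  refine _root_.tendsto_spectralMoment hc₀ hf hv hv1 hve ha hβ hδ hC ?_ ?_ ?_ ?_
  · filter_upwards [eventually_gt_atTop 0] with m hm0
    have hm' : (0 : ℝ) < m := by exact_mod_cast hm0
    positivity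
  · exact tendsto_truncMoment_sub_div_rpow hwc hwb (by linarith) (by linarith) hβa
  · refine ((tendsto_truncMoment hwc hwb (q := 3 - a - β) (by linarith) (by linarith)).comp
      tendsto_natCast_mul_pi).congr' ?_
    filter_upwards [eventually_gt_atTop 0] with m hm0
    have hm' : (0 : ℝ) < m := by exact_mod_cast hm0
    have : (m : ℝ) ^ (-β) ≠ 0 := (Real.rpow_pos_of_pos hm' _).ne'
    rw [mul_div_cancel_left₀ _ this]; rfl
  · have h1 := (tendsto_truncMoment continuous_sinWeight abs_sinWeight_le (q := 3 - a - β - δ)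
      (by linarith) (by linarith)).comp tendsto_natCast_mul_pi
    have h2 := (tendsto_natCast_rpow_neg hδ).mul h1
    rw [zero_mul] at h2
    refine h2.congr' ?_
    filter_upwards [eventually_gt_atTop 0] with m hm0
    have hm' : (0 : ℝ) < m := by exact_mod_cast hm0
    have h3 : (m : ℝ) ^ (-β) ≠ 0 := (Real.rpow_pos_of_pos hm' _).ne'
    have h4 : (m : ℝ) ^ (-β - δ) = m ^ (-β) * m ^ (-δ) := by
      rw [← Real.rpow_add hm']; congr 1
    rw [h4, mul_assoc, mul_div_cancel_left₀ _ h3]; rfl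

/-! ### The logarithmic case `d = 1/2`, `β = 2`. -/

theorem tendsto_log_natCast : Tendsto (fun m : ℕ ↦ Real.log m) atTop atTop :=
  Real.tendsto_log_atTop.comp tendsto_natCast_atTop_atTop

theorem tendsto_truncMoment_zero_div_log {w W : ℝ → ℝ} (hw : Continuous w)
    (hb : ∀ x, |w x| ≤ sinWeight x) {c B : ℝ} (hW : ∀ x, HasDerivAt W (w x - c) x)
    (hWB : ∀ x, |W x| ≤ B) :
    Tendsto (fun m : ℕ ↦ truncMoment w 0 (m * Real.pi) / Real.log m) atTop (𝓝 c) := by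
  obtain ⟨M, hM⟩ := exists_abs_truncMoment_zero_sub_le hw hb hW hWB
  have hl : ∀ᶠ m : ℕ in atTop, 0 < Real.log m := tendsto_log_natCast.eventually_gt_atTop 0
  have h1 : Tendsto (fun m : ℕ ↦ (truncMoment w 0 (m * Real.pi) - c * Real.log (m * Real.pi)) /
      Real.log m) atTop (𝓝 0) := by
    refine squeeze_zero_norm' ?_ (tendsto_const_nhds (x := M).div_atTop tendsto_log_natCast)
    filter_upwards [hl, eventually_ge_atTop 1] with m hlm hm
    have hm' : (1 : ℝ) ≤ m := by exact_mod_cast hm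
    rw [norm_div, Real.norm_eq_abs, Real.norm_eq_abs, abs_of_pos hlm]
    gcongr
    exact hM _ (by nlinarith [Real.pi_gt_three])
  have h2 : Tendsto (fun m : ℕ ↦ c * Real.log Real.pi / Real.log m) atTop (𝓝 0) :=
    tendsto_const_nhds.div_atTop tendsto_log_natCast
  have h3 := (h1.add h2).add_const c
  rw [zero_add, zero_add] at h3
  refine h3.congr' ?_
  filter_upwards [hl, eventually_ge_atTop 1] with m hlm hm
  have hm' : (m : ℝ) ≠ 0 := by positivity
  rw [Real.log_mul hm' Real.pi_ne_zero]
  field_simp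
  ring

theorem truncMoment_sinWeight_neg_le {δ R : ℝ} (hδ : 0 < δ) (hR : 0 ≤ R) :
    |truncMoment sinWeight (-δ) R| ≤ R ^ δ / δ := by
  have hI : ∫ x in (0 : ℝ)..R, x ^ (δ - 1) = R ^ δ / δ := by
    rw [integral_rpow (Or.inl (by linarith)), sub_add_cancel, Real.zero_rpow hδ.ne', sub_zero]
  rw [← hI, ← Real.norm_eq_abs, truncMoment, neg_neg]
  refine intervalIntegral.norm_integral_le_of_norm_le hR (Eventually.of_forall fun x hx ↦ ?_)
    (intervalIntegral.intervalIntegrable_rpow' (by linarith))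
  rw [norm_mul, Real.norm_eq_abs, Real.norm_eq_abs, abs_of_pos (Real.rpow_pos_of_pos hx.1 _)]
  exact mul_le_of_le_one_right (Real.rpow_nonneg hx.1.le _)
    ((abs_sinWeight_le x).trans (sinWeight_le_one x))

/-- The second moment has order zero and grows like `c log m`, where the bounded primitive `W`
identifies `c` as the mean of the weight. The remainder moment grows like `m ^ δ`, which only
offsets `m ^ (-δ)`; the decay comes from the logarithm. -/
theorem SpectralExpansion.tendsto_spectralMoment_log {f v W : ℝ → ℝ} {c₀ c₁ c B : ℝ} (hc₀ : 0 < c₀)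
    (h : SpectralExpansion f 1 2 c₀ c₁)
    (hf : IntegrableOn f (Set.Icc (-Real.pi) Real.pi)) (hv : Continuous v)
    (hv1 : ∀ x, |v x| ≤ 1) (hve : ∀ x, v (-x) = v x)
    (hW : ∀ x, HasDerivAt W (v x * sinWeight x - c) x) (hWB : ∀ x, |W x| ≤ B) :
    Tendsto (fun m : ℕ ↦ (spectralMoment v f m / (32 * c₀ * (m : ℝ) ^ (3 - 1 : ℝ)) -
      halfMoment (fun x ↦ v x * sinWeight x) (3 - 1)) / ((m : ℝ) ^ (-2 : ℝ) * Real.log m)) atTop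
      (𝓝 (secondOrderCoeff 2 c₀ c₁ * c)) := by
  obtain ⟨δ, hδ, hex⟩ := h.exists_abs_div_sinWeight_le hc₀ le_rfl
  obtain ⟨C, -, hC⟩ := hex δ hδ le_rfl
  have hwc : Continuous fun x ↦ v x * sinWeight x := hv.mul continuous_sinWeight
  have hwb : ∀ x, |v x * sinWeight x| ≤ sinWeight x := fun x ↦ by
    rw [abs_mul, abs_of_nonneg (sinWeight_nonneg x)]
    exact mul_le_of_le_one_left (sinWeight_nonneg x) (hv1 x)
  have hl : ∀ᶠ m : ℕ in atTop, 0 < Real.log m := tendsto_log_natCast.eventually_gt_atTop 0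
  have hpi := Real.pi_pos
  refine _root_.tendsto_spectralMoment hc₀ hf hv hv1 hve (by norm_num) two_pos hδ hC ?_ ?_ ?_ ?_
  · filter_upwards [hl, eventually_gt_atTop 0] with m hlm hm0
    have hm' : (0 : ℝ) < m := by exact_mod_cast hm0
    positivity
  · refine squeeze_zero_norm' ?_
      (tendsto_const_nhds (x := Real.pi ^ (-2 : ℝ) / 2).div_atTop tendsto_log_natCast)
    filter_upwards [hl, eventually_gt_atTop 0] with m hlm hm0
    have hm' : (0 : ℝ) < m := by exact_mod_cast hm0
    have hle := abs_halfMoment_sub_truncMoment_le hwc hwb (q := 3 - 1) (by norm_num) (by norm_num)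
      (mul_pos hm' hpi)
    have hp : 0 < (m : ℝ) ^ (-2 : ℝ) * Real.log m := by positivity
    rw [norm_div, Real.norm_eq_abs, Real.norm_eq_abs, abs_of_pos hp, div_le_iff₀ hp]
    refine hle.trans (le_of_eq ?_)
    rw [show (3 - 1 : ℝ) = 2 by norm_num, Real.mul_rpow hm'.le hpi.le]
    field_simp
  · have e : (3 - 1 - 2 : ℝ) = 0 := by norm_num
    rw [e]
    refine (tendsto_truncMoment_zero_div_log hwc hwb hW hWB).congr' ?_
    filter_upwards [eventually_gt_atTop 0] with m hm0
    have hm' : (0 : ℝ) < m := by exact_mod_cast hm0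
    have : (m : ℝ) ^ (-2 : ℝ) ≠ 0 := (Real.rpow_pos_of_pos hm' _).ne'
    rw [mul_div_mul_left _ _ this]
  · have e : (3 - 1 - 2 - δ : ℝ) = -δ := by ring
    rw [e]
    refine squeeze_zero_norm' ?_
      (tendsto_const_nhds (x := Real.pi ^ δ / δ).div_atTop tendsto_log_natCast)
    filter_upwards [hl, eventually_gt_atTop 0] with m hlm hm0
    have hm' : (0 : ℝ) < m := by exact_mod_cast hm0
    have hp : 0 < (m : ℝ) ^ (-2 : ℝ) := Real.rpow_pos_of_pos hm' _
    have hq : 0 < (m : ℝ) ^ (-δ) := Real.rpow_pos_of_pos hm' _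
    have h4 : (m : ℝ) ^ (-2 - δ) = m ^ (-2 : ℝ) * m ^ (-δ) := by
      rw [← Real.rpow_add hm']; congr 1
    have hle := truncMoment_sinWeight_neg_le hδ (mul_pos hm' hpi).le
    rw [h4, mul_assoc, mul_div_mul_left _ _ hp.ne', norm_div, norm_mul, Real.norm_eq_abs,
      Real.norm_eq_abs, Real.norm_eq_abs, abs_of_pos hlm, abs_of_pos hq]
    gcongr
    calc (m : ℝ) ^ (-δ) * |truncMoment sinWeight (-δ) (m * Real.pi)|
        ≤ (m : ℝ) ^ (-δ) * ((m * Real.pi) ^ δ / δ) := by gcongr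
      _ = Real.pi ^ δ / δ := by
        rw [Real.mul_rpow hm'.le hpi.le]
        have : (m : ℝ) ^ (-δ) * (m : ℝ) ^ δ = 1 := by rw [← Real.rpow_add hm']; simp
        rw [← mul_div_assoc, ← mul_assoc, this, one_mul]

/-- Supplies the mean value `3/8` of the variance weight; the factor `1` matches the form `v x *
sinWeight x`. -/
theorem hasDerivAt_sinWeight_primitive (x : ℝ) :
    HasDerivAt (fun x ↦ (-4 * Real.sin x + Real.sin (2 * x) / 2) / 8)
      (1 * sinWeight x - 3 / 8) x := by
  have h2 : HasDerivAt (fun x ↦ Real.sin (2 * x)) (Real.cos (2 * x) * 2) x := by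
    have := ((hasDerivAt_id x).const_mul 2).sin
    rwa [mul_one] at this
  have h := (((Real.hasDerivAt_sin x).const_mul (-4)).add (h2.div_const 2)).div_const 8
  refine h.congr_deriv ?_
  have e := cosDefect_two x
  rw [cosDefect] at e
  linarith

theorem hasDerivAt_cos_mul_sinWeight_primitive (x : ℝ) :
    HasDerivAt (fun x ↦ (7 * Real.sin x - 2 * Real.sin (2 * x) + Real.sin (3 * x) / 3) / 16)
      (Real.cos x * sinWeight x - -1 / 4) x := by
  have h2 : HasDerivAt (fun x ↦ Real.sin (2 * x)) (Real.cos (2 * x) * 2) x := by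
    have := ((hasDerivAt_id x).const_mul 2).sin
    rwa [mul_one] at this
  have h3 : HasDerivAt (fun x ↦ Real.sin (3 * x)) (Real.cos (3 * x) * 3) x := by
    have := ((hasDerivAt_id x).const_mul 3).sin
    rwa [mul_one] at this
  have h := ((((Real.hasDerivAt_sin x).const_mul 7).sub (h2.const_mul 2)).add
    (h3.div_const 3)).div_const 16
  refine h.congr_deriv ?_
  have e := cosDefect_two x
  have e' := cosDefect_three x
  rw [cosDefect] at e e'
  linarith

/-- Second order expansion of the block variance and the lagged block covariance. -/
theorem exists_spectralMoment_rate {d β : ℝ} (hd : 1 / 2 ≤ d) (hd' : d < 3 / 2) (hβ : 0 < β)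
    (hβ' : β ≤ 2) :
    ∃ (η : ℕ → ℝ) (B : ℝ), 0 < B ∧ Tendsto η atTop (𝓝 0) ∧ (∀ᶠ m in atTop, η m ≠ 0) ∧
      (β < 1 + 2 * d → ∀ m, η m = (m : ℝ) ^ (-β)) ∧
      (β = 2 → d = 1 / 2 → ∀ m, η m = (m : ℝ) ^ (-2 : ℝ) * Real.log m) ∧
      ∀ (f : ℝ → ℝ) (c₀ c₁ : ℝ), 0 < c₀ → IntegrableOn f (Set.Icc (-Real.pi) Real.pi) →
        SpectralExpansion f (2 - 2 * d) β c₀ c₁ →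
        Tendsto (fun m : ℕ ↦ (spectralMoment (fun _ ↦ 1) f m /
          (32 * c₀ * (m : ℝ) ^ (1 + 2 * d)) - varMoment (1 + 2 * d)) / η m) atTop
          (𝓝 (secondOrderCoeff β c₀ c₁ * B)) ∧
        Tendsto (fun m : ℕ ↦ (spectralMoment Real.cos f m /
          (32 * c₀ * (m : ℝ) ^ (1 + 2 * d)) - covMoment (1 + 2 * d)) / η m) atTop
          (𝓝 (secondOrderCoeff β c₀ c₁ * ((secantRatio (1 + 2 * d - β) - 2) * B))) := by
  have e3 : 3 - (2 - 2 * d) = 1 + 2 * d := by ring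
  have eone : (fun x ↦ 1 * sinWeight x) = sinWeight := by ext; simp
  by_cases hlt : β < 1 + 2 * d
  · have hcov := covMoment_add_two_mul (q := 1 + 2 * d - β) (by linarith) (by linarith)
    refine ⟨fun m ↦ (m : ℝ) ^ (-β), varMoment (1 + 2 * d - β),
      varMoment_pos (by linarith) (by linarith), tendsto_natCast_rpow_neg hβ, ?_,
      fun _ _ ↦ rfl, fun h2 hd2 ↦ absurd hlt (by rw [h2, hd2]; norm_num), fun f c₀ c₁ hc₀ hf h ↦ ?_⟩
    · filter_upwards [eventually_gt_atTop 0] with m hm0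
      have hm' : (0 : ℝ) < m := by exact_mod_cast hm0
      positivity
    · have h1 := h.tendsto_spectralMoment hc₀ hf (v := fun _ ↦ 1) continuous_const (by simp)
        (by simp) (by linarith) hβ hβ' (by linarith)
      have h2 := h.tendsto_spectralMoment hc₀ hf (v := Real.cos) Real.continuous_cos
        Real.abs_cos_le_one Real.cos_neg (by linarith) hβ hβ' (by linarith)
      rw [e3] at h1 h2
      rw [eone] at h1
      refine ⟨h1, ?_⟩
      have : (secantRatio (1 + 2 * d - β) - 2) * varMoment (1 + 2 * d - β) =
          covMoment (1 + 2 * d - β) := by linarith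
      rw [this]
      exact h2
  · obtain rfl : β = 2 := by linarith
    obtain rfl : d = 1 / 2 := by linarith
    have hl : ∀ᶠ m : ℕ in atTop, 0 < Real.log m := tendsto_log_natCast.eventually_gt_atTop 0
    refine ⟨fun m ↦ (m : ℝ) ^ (-2 : ℝ) * Real.log m, 3 / 8, by norm_num, ?_, ?_,
      fun h ↦ absurd h hlt, fun _ _ _ ↦ rfl, fun f c₀ c₁ hc₀ hf h ↦ ?_⟩
    · have := ((isLittleO_log_rpow_atTop two_pos).tendsto_div_nhds_zero).comp
        (tendsto_natCast_atTop_atTop (R := ℝ))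
      refine this.congr fun m ↦ ?_
      simp only [Function.comp_apply]
      rw [Real.rpow_neg (Nat.cast_nonneg m)]
      field_simp
    · filter_upwards [hl, eventually_gt_atTop 0] with m hlm hm0
      have hm' : (0 : ℝ) < m := by exact_mod_cast hm0
      positivity
    · rw [show (2 - 2 * (1 / 2) : ℝ) = 1 by norm_num] at h
      have h1 := h.tendsto_spectralMoment_log hc₀ hf (v := fun _ ↦ 1) continuous_const (by simp)
        (by simp) hasDerivAt_sinWeight_primitive (B := 1) (fun x ↦ by
          have a1 := abs_le.1 (Real.abs_sin_le_one x)
          have a2 := abs_le.1 (Real.abs_sin_le_one (2 * x))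
          rw [abs_le]; constructor <;> linarith)
      have h2 := h.tendsto_spectralMoment_log hc₀ hf (v := Real.cos) Real.continuous_cos
        Real.abs_cos_le_one Real.cos_neg hasDerivAt_cos_mul_sinWeight_primitive (B := 1) (fun x ↦ by
          have a1 := abs_le.1 (Real.abs_sin_le_one x)
          have a2 := abs_le.1 (Real.abs_sin_le_one (2 * x))
          have a3 := abs_le.1 (Real.abs_sin_le_one (3 * x))
          rw [abs_le]; constructor <;> linarith)
      have e2 : (1 + 2 * (1 / 2) : ℝ) = 3 - 1 := by norm_num
      have e0 : (3 - 1 - 2 : ℝ) = 0 := by norm_num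
      rw [eone] at h1
      rw [e2, e0, secantRatio_zero]
      refine ⟨h1, ?_⟩
      -- The mean values `-1/4` and `3/8` have ratio `secantRatio 0 - 2`, so one formula for the
      -- covariance serves both rates.
      rw [show ((4 / 3 - 2) * (3 / 8) : ℝ) = -1 / 4 by norm_num]
      exact h2

/-! ### Derivative of `Λ`, and first-order limits of quotients and compositions. -/

/-- With `s = √((1 + r) / (1 - r))`, the derivative of the arctangent term cancels the one that
falls on the logarithm. There remains `s' log(2 / (1 + r)) / π`, which is positive. -/
theorem exists_hasDerivAt_irLambda {r : ℝ} (h1 : -1 < r) (h2 : r < 1) :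
    ∃ L, 0 < L ∧ HasDerivAt irLambda L r := by
  have h3 : 0 < 1 + r := by linarith
  have h4 : 0 < 1 - r := by linarith
  have hpi := Real.pi_pos
  have hq : HasDerivAt (fun r : ℝ ↦ (1 + r) / (1 - r)) (2 / (1 - r) ^ 2) r := by
    have := ((hasDerivAt_id r).const_add 1).div ((hasDerivAt_id r).const_sub 1) h4.ne'
    refine this.congr_deriv ?_
    simp only [id]
    ring
  set s := √((1 + r) / (1 - r)) with hs
  have hs0 : 0 < s := Real.sqrt_pos.2 (by positivity)
  have hs2 : s ^ 2 = (1 + r) / (1 - r) := Real.sq_sqrt (by positivity)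
  have hsd := hq.sqrt (by positivity)
  have hl : HasDerivAt (fun r : ℝ ↦ Real.log (2 / (1 + r))) (-(1 / (1 + r))) r := by
    have hdiv : HasDerivAt (fun r : ℝ ↦ 2 / (1 + r)) (-2 / (1 + r) ^ 2) r := by
      have := (hasDerivAt_const r (2 : ℝ)).div ((hasDerivAt_id r).const_add 1) h3.ne'
      refine this.congr_deriv ?_
      simp
    refine (hdiv.log (by positivity)).congr_deriv ?_
    field_simp
  have hlog : 0 < Real.log (2 / (1 + r)) := Real.log_pos (by rw [lt_div_iff₀ h3]; linarith)
  have hmain := (hsd.arctan.const_mul (2 / Real.pi)).add ((hsd.const_mul (1 / Real.pi)).mul hl)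
  refine ⟨1 / Real.pi * (2 / (1 - r) ^ 2 / (2 * s)) * Real.log (2 / (1 + r)), by positivity,
    hmain.congr_deriv ?_⟩
  rw [← hs, hs2]
  have e1 : 1 + (1 + r) / (1 - r) = 2 / (1 - r) := by field_simp; ring
  rw [e1]
  have e2 : s / (1 + r) = 1 / (s * (1 - r)) := by
    rw [div_eq_div_iff h3.ne' (by positivity)]
    have : s * (s * (1 - r)) = s ^ 2 * (1 - r) := by ring
    rw [this, hs2]; field_simp
  have e3 : 1 / Real.pi * s * -(1 / (1 + r)) = -(1 / Real.pi * (s / (1 + r))) := by ring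
  rw [e3, e2]
  field_simp
  ring

theorem tendsto_of_sub_div_tendsto {u η : ℕ → ℝ} {A B : ℝ} (hη : Tendsto η atTop (𝓝 0))
    (hη0 : ∀ᶠ m in atTop, η m ≠ 0)
    (h : Tendsto (fun m ↦ (u m - A) / η m) atTop (𝓝 B)) : Tendsto u atTop (𝓝 A) := by
  have h1 := (h.mul hη).add_const A
  rw [mul_zero, zero_add] at h1
  refine h1.congr' ?_
  filter_upwards [hη0] with m hm
  field_simp
  ring

theorem tendsto_div_sub_div {u v η : ℕ → ℝ} {A A' B B' : ℝ} (hA : A ≠ 0)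
    (hη : Tendsto η atTop (𝓝 0)) (hη0 : ∀ᶠ m in atTop, η m ≠ 0)
    (hu : Tendsto (fun m ↦ (u m - A) / η m) atTop (𝓝 B))
    (hv : Tendsto (fun m ↦ (v m - A') / η m) atTop (𝓝 B')) :
    Tendsto (fun m ↦ (v m / u m - A' / A) / η m) atTop (𝓝 ((B' * A - A' * B) / (A * A))) := by
  have hu' := tendsto_of_sub_div_tendsto hη hη0 hu
  have h := ((hv.mul_const A).sub (hu.const_mul A')).div (hu'.mul_const A) (mul_ne_zero hA hA)
  refine h.congr' ?_
  filter_upwards [hη0, hu'.eventually_ne hA] with m hm hum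
  simp only [Pi.div_apply]
  field_simp
  ring

/-- A chain rule along sequences; `dslope` is continuous at `ρ` and handles the indices with `u m =
ρ`. -/
theorem HasDerivAt.tendsto_sub_div {g : ℝ → ℝ} {L ρ B : ℝ} (hg : HasDerivAt g L ρ)
    {u η : ℕ → ℝ} (hη : Tendsto η atTop (𝓝 0)) (hη0 : ∀ᶠ m in atTop, η m ≠ 0)
    (hu : Tendsto (fun m ↦ (u m - ρ) / η m) atTop (𝓝 B)) :
    Tendsto (fun m ↦ (g (u m) - g ρ) / η m) atTop (𝓝 (L * B)) := by
  have hu' := tendsto_of_sub_div_tendsto hη hη0 hu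
  have hd : Tendsto (fun m ↦ dslope g ρ (u m)) atTop (𝓝 L) := by
    have := (continuousAt_dslope_same.2 hg.differentiableAt).tendsto.comp hu'
    rwa [dslope_same, hg.deriv] at this
  refine (hd.mul hu).congr fun m ↦ ?_
  rw [← sub_smul_dslope g ρ (u m), smul_eq_mul]
  ring

/-! ### The statistic: Gaussianity, stationarity and exact mean. -/

section Increments

variable {Ω : Type*} [MeasurableSpace Ω] {P : Measure Ω} {X : ℤ → Ω → ℝ}

theorem blockIncrement_add (x y : ℤ → ℝ) (k l : ℤ) :
    blockIncrement (fun t ↦ x t + y t) k l = blockIncrement x k l + blockIncrement y k l := by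
  simp only [blockIncrement, Finset.sum_add_distrib]; ring

theorem blockIncrement_smul (c : ℝ) (x : ℤ → ℝ) (k l : ℤ) :
    blockIncrement (fun t ↦ c * x t) k l = c * blockIncrement x k l := by
  simp only [blockIncrement, ← Finset.mul_sum]; ring

theorem isGaussianProcess_blockIncrement (hX : IsGaussianProcess X P) (m : ℕ) :
    IsGaussianProcess (fun (k : ℤ) ω ↦ blockIncrement (fun t ↦ X t ω) k m) P := by
  refine hX.of_isGaussianProcess fun k ↦ ?_
  -- The finite window of times entering the block increment; paths are extended by zero outside it.
  let I : Finset ℤ := Finset.Icc (k + 1) (k + m + m)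
  let L : (I → ℝ) →ₗ[ℝ] ℝ :=
    { toFun x := blockIncrement (fun t ↦ if h : t ∈ I then x ⟨t, h⟩ else 0) k m
      map_add' x y := by
        rw [← blockIncrement_add]
        congr 1; ext t; split_ifs <;> simp
      map_smul' c x := by
        rw [RingHom.id_apply, smul_eq_mul, ← blockIncrement_smul]
        congr 1; ext t; split_ifs <;> simp }
  refine ⟨I, L.toContinuousLinearMap, fun ω ↦ ?_⟩
  simp only [LinearMap.coe_toContinuousLinearMap', L, LinearMap.coe_mk, AddHom.coe_mk,
    blockIncrement, Finset.restrict]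
  congr 1
  · refine Finset.sum_congr rfl fun t ht ↦ ?_
    rw [Finset.mem_Icc] at ht
    rw [dif_pos (by simp only [I, Finset.mem_Icc]; omega)]
  · refine Finset.sum_congr rfl fun t ht ↦ ?_
    rw [Finset.mem_Icc] at ht
    rw [dif_pos (by simp only [I, Finset.mem_Icc]; omega)]

variable [IsProbabilityMeasure P] {f : ℝ → ℝ}

theorem HasSpectralDensity.covariance_blockIncrement
    (h : HasSpectralDensity P (fun t ω ↦ X t ω - X (t - 1) ω) f) (k l : ℤ) (m : ℕ) :
    cov[fun ω ↦ blockIncrement (fun t ↦ X t ω) k m, fun ω ↦ blockIncrement (fun t ↦ X t ω) l m; P] =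
      ∫ x in (-Real.pi)..Real.pi, Real.cos ((k - l) * x) * ‖expSum m x‖ ^ 4 * f x := by
  simp only [blockIncrement_eq_sum_increments]
  exact h.covariance_blockSum k l m

theorem HasSpectralDensity.covariance_blockIncrement_self
    (h : HasSpectralDensity P (fun t ω ↦ X t ω - X (t - 1) ω) f) (k : ℤ) (m : ℕ) :
    cov[fun ω ↦ blockIncrement (fun t ↦ X t ω) k m, fun ω ↦ blockIncrement (fun t ↦ X t ω) k m; P] =
      spectralMoment (fun _ ↦ 1) f m := by
  rw [h.covariance_blockIncrement, spectralMoment]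
  simp

theorem HasSpectralDensity.covariance_blockIncrement_add
    (h : HasSpectralDensity P (fun t ω ↦ X t ω - X (t - 1) ω) f) (k : ℤ) (m : ℕ) :
    cov[fun ω ↦ blockIncrement (fun t ↦ X t ω) k m,
      fun ω ↦ blockIncrement (fun t ↦ X t ω) (k + m) m; P] = spectralMoment Real.cos f m := by
  rw [h.covariance_blockIncrement, spectralMoment]
  refine intervalIntegral.integral_congr fun x _ ↦ ?_
  have : ((k : ℝ) - ((k + m : ℤ) : ℝ)) * x = -(m * x) := by push_cast; ring
  simp only [this, Real.cos_neg]

theorem integral_blockIncrement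
    (h : HasSpectralDensity P (fun t ω ↦ X t ω - X (t - 1) ω) f)
    (h0 : ∀ t : ℤ, ∫ ω, (X t ω - X (t - 1) ω) ∂P = 0) (k : ℤ) (m : ℕ) :
    ∫ ω, blockIncrement (fun t ↦ X t ω) k m ∂P = 0 := by
  simp only [blockIncrement_eq_sum_increments]
  rw [integral_finsetSum]
  · exact Finset.sum_eq_zero fun p _ ↦ h0 _
  · exact fun p _ ↦ (h.memLp _).integrable one_le_two

/-- The variances and the lagged covariance do not depend on `k`, so all `N - 3m` summands have the
same mean and the average removes `N`. -/
theorem integral_incrementRatio (hX : IsGaussianProcess X P)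
    (h : HasSpectralDensity P (fun t ω ↦ X t ω - X (t - 1) ω) f)
    (h0 : ∀ t : ℤ, ∫ ω, (X t ω - X (t - 1) ω) ∂P = 0) {m N : ℕ} (hN : 3 * m < N)
    (h1 : |spectralMoment Real.cos f m| < spectralMoment (fun _ ↦ 1) f m) :
    Integrable (fun ω ↦ incrementRatio (fun t ↦ X t ω) N m) P ∧
      ∫ ω, incrementRatio (fun t ↦ X t ω) N m ∂P =
        irLambda (spectralMoment Real.cos f m / spectralMoment (fun _ ↦ 1) f m) := by
  have hG := isGaussianProcess_blockIncrement hX m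
  set D : ℤ → Ω → ℝ := fun k ω ↦ blockIncrement (fun t ↦ X t ω) k m with hD
  have hint : ∀ k : ℤ, Integrable (fun ω ↦ |D k ω + D (k + m) ω| /
      (|D k ω| + |D (k + m) ω|)) P := fun k ↦ by
    have m1 := hG.aemeasurable k
    have m2 := hG.aemeasurable (k + m)
    refine Integrable.of_bound (C := 1) ?_ (Eventually.of_forall fun ω ↦ ?_)
    · exact (AEMeasurable.div (by fun_prop) (by fun_prop)).aestronglyMeasurable
    · rw [Real.norm_eq_abs, abs_of_nonneg (by positivity)]
      exact div_le_one_of_le₀ (abs_add_le _ _) (by positivity)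
  have hval : ∀ k : ℤ, ∫ ω, |D k ω + D (k + m) ω| / (|D k ω| + |D (k + m) ω|) ∂P =
      irLambda (spectralMoment Real.cos f m / spectralMoment (fun _ ↦ 1) f m) := fun k ↦ by
    exact integral_gaussian_ratio hG.hasGaussianLaw_prodMk (integral_blockIncrement h h0 k m)
      (integral_blockIncrement h h0 (k + m) m) (h.covariance_blockIncrement_self k m)
      (h.covariance_blockIncrement_self (k + m) m) (h.covariance_blockIncrement_add k m)
      (neg_lt_of_abs_lt h1) (lt_of_abs_lt h1)
  have hsum : Integrable (fun ω ↦ ∑ k ∈ Finset.range (N - 3 * m),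
      |D k ω + D (k + m) ω| / (|D k ω| + |D (k + m) ω|)) P :=
    integrable_finsetSum _ fun k _ ↦ hint k
  refine ⟨hsum.const_mul _, ?_⟩
  change ∫ ω, 1 / ((N : ℝ) - 3 * (m : ℝ)) * ∑ k ∈ Finset.range (N - 3 * m),
    |D k ω + D (k + m) ω| / (|D k ω| + |D (k + m) ω|) ∂P = _
  rw [integral_const_mul, integral_finsetSum _ fun (k : ℕ) _ ↦ hint k,
    Finset.sum_congr rfl fun (k : ℕ) _ ↦ hval k, Finset.sum_const, Finset.card_range, nsmul_eq_mul,
    Nat.cast_sub hN.le]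
  have hne : (N : ℝ) - 3 * m ≠ 0 := by
    have : (3 * m : ℝ) < N := by exact_mod_cast hN
    linarith
  push_cast
  rw [← mul_assoc, one_div, inv_mul_cancel₀ hne, one_mul]

end Increments

/-! ### The bias expansion. -/

theorem mainTheorem2 (d β : ℝ) (hd : 1 / 2 ≤ d) (hd' : d < 3 / 2) (hβ : 0 < β) (hβ' : β ≤ 2) :
    ∃ K : ℝ, K ≠ 0 ∧
      ∀ (Ω : Type*) [MeasurableSpace Ω] (P : Measure Ω) [IsProbabilityMeasure P]
        (X : ℤ → Ω → ℝ) (c₀ c₁ : ℝ),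
        IsIG P X d β c₀ c₁ →
        (∀ t : ℤ, ∫ ω, (X t ω - X (t - 1) ω) ∂P = 0) →
        ∃ r : ℕ → ℝ, Tendsto r atTop (𝓝 0) ∧
          ∃ m₀ : ℕ, ∀ m ≥ m₀, ∀ N : ℕ, 3 * m < N →
            Integrable (fun ω ↦ incrementRatio (fun t ↦ X t ω) N m) P ∧
            (β < 1 + 2 * d →
              ∫ ω, incrementRatio (fun t ↦ X t ω) N m ∂P =
                irLambda₀ d + K * (m : ℝ) ^ (-β) * (secondOrderCoeff β c₀ c₁ + r m)) ∧
            (β = 2 → d = 1 / 2 →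
              ∫ ω, incrementRatio (fun t ↦ X t ω) N m ∂P =
                irLambda₀ d +
                  K * ((m : ℝ) ^ (-2 : ℝ) * Real.log m) * (secondOrderCoeff β c₀ c₁ + r m)) := by
  obtain ⟨η, B, hB, hη, hη0, hη1, hη2, hmom⟩ := exists_spectralMoment_rate hd hd' hβ hβ'
  set p := 1 + 2 * d with hp
  have hp0 : 0 < p := by linarith
  have hp4 : p < 4 := by linarith
  have hA := varMoment_pos hp0 hp4
  have hCV := abs_covMoment_lt hp0 hp4
  have hcov : covMoment p = (secantRatio p - 2) * varMoment p := by
    linarith [covMoment_add_two_mul hp0 hp4]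
  have hρ : irRho d = covMoment p / varMoment p := by
    rw [irRho_eq, hcov, mul_div_cancel_right₀ _ hA.ne']
  have hρ1 : -1 < irRho d := by
    rw [hρ, lt_div_iff₀ hA]; linarith [neg_lt_of_abs_lt hCV]
  have hρ2 : irRho d < 1 := by
    rw [hρ, div_lt_one hA]; exact lt_of_abs_lt hCV
  obtain ⟨L, hL, hder⟩ := exists_hasDerivAt_irLambda hρ1 hρ2
  have hsec : secantRatio (p - β) - secantRatio p ≠ 0 := by
    have := strictMono_secantRatio (show p - β < p by linarith)
    linarith [this] |> fun (h : secantRatio (p - β) - secantRatio p < 0) ↦ h.ne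
  -- `Λ'` at the limit times the first-order change of the correlation per unit of `θ`. Only `d` and
  -- `β` enter, as the process is introduced later.
  set K := L * (B * (secantRatio (p - β) - secantRatio p) / varMoment p) with hK
  have hK0 : K ≠ 0 := mul_ne_zero hL.ne' (div_ne_zero (mul_ne_zero hB.ne' hsec) hA.ne')
  refine ⟨K, hK0, ?_⟩
  intro Ω _ P _ X c₀ c₁ hIG hmean
  obtain ⟨hX, hc₀, -, hf⟩ := hIG
  obtain ⟨f, hsd, hexp⟩ := hf hd
  obtain ⟨hv, hc⟩ := hmom f c₀ c₁ hc₀ hsd.integrableOn hexp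
  set θ := secondOrderCoeff β c₀ c₁ with hθ
  set S : ℕ → ℝ := fun m ↦ 32 * c₀ * (m : ℝ) ^ p with hS
  set V : ℕ → ℝ := fun m ↦ spectralMoment (fun _ ↦ 1) f m with hV
  set C : ℕ → ℝ := fun m ↦ spectralMoment Real.cos f m with hC
  have hS0 : ∀ᶠ m in atTop, 0 < S m := by
    filter_upwards [eventually_gt_atTop 0] with m hm0
    have hm' : (0 : ℝ) < m := by exact_mod_cast hm0
    rw [hS]; positivity
  have hv' := tendsto_of_sub_div_tendsto hη hη0 hv
  have hc' := tendsto_of_sub_div_tendsto hη hη0 hc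
  have hlt : ∀ᶠ m in atTop, |C m| < V m := by
    filter_upwards [hc'.abs.eventually_lt hv' hCV, hS0] with m hm hSm
    rwa [abs_div, abs_of_pos hSm, div_lt_div_iff_of_pos_right hSm] at hm
  have hratio : Tendsto (fun m ↦ (C m / V m - irRho d) / η m) atTop
      (𝓝 (θ * (B * (secantRatio (p - β) - secantRatio p) / varMoment p))) := by
    have h := tendsto_div_sub_div hA.ne' hη hη0 hv hc
    have e : (θ * ((secantRatio (p - β) - 2) * B) * varMoment p - covMoment p * (θ * B)) /
        (varMoment p * varMoment p) =
        θ * (B * (secantRatio (p - β) - secantRatio p) / varMoment p) := by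
      rw [hcov]; field_simp; ring
    rw [e, ← hρ] at h
    refine h.congr' ?_
    filter_upwards [hS0] with m hm
    rw [div_div_div_cancel_right₀ hm.ne']
  have hΛ := hder.tendsto_sub_div hη hη0 hratio
  -- The error is obtained by solving the claimed identity for it, so the content is its convergence
  -- to `0`. It does not involve `N`.
  refine ⟨fun m ↦ (irLambda (C m / V m) - irLambda (irRho d)) / η m / K - θ, ?_, ?_⟩
  · have h := (hΛ.div_const K).sub_const θ
    have e : L * (θ * (B * (secantRatio (p - β) - secantRatio p) / varMoment p)) / K - θ = 0 := by
      have : L * (θ * (B * (secantRatio (p - β) - secantRatio p) / varMoment p)) = θ * K := by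
        rw [hK]; ring
      rw [this, mul_div_cancel_right₀ _ hK0, sub_self]
    rwa [e] at h
  · obtain ⟨m₀, hm₀⟩ := eventually_atTop.1 (hlt.and hη0)
    refine ⟨m₀, fun m hm N hN ↦ ?_⟩
    obtain ⟨h1, h2⟩ := hm₀ m hm
    obtain ⟨hi, hval⟩ := integral_incrementRatio hX hsd hmean hN h1
    have key : ∫ ω, incrementRatio (fun t ↦ X t ω) N m ∂P = irLambda₀ d + K * η m *
        (θ + ((irLambda (C m / V m) - irLambda (irRho d)) / η m / K - θ)) := by
      rw [hval, irLambda₀]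
      field_simp
      ring
    refine ⟨hi, fun hlt' ↦ ?_, fun hb2 hd2 ↦ ?_⟩
    · rw [← hη1 hlt' m]; exact key
    · rw [← hη2 hb2 hd2 m]; exact key
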